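/- Let $s\ge 1$, let $\pi=(\pi_1,\dots,\pi_s)$ be a probability vector, and let $p_{ij}=\pi_i\pi_j$, a probability vector on $[s]^2$. Let $\Delta_{s^2}(\pi)$ be the set of probability vectors $\alpha=(\alpha_{ij})$ on $[s]^2$ both of whose marginals are $\pi$, and let $D(\alpha,p)=\sum_{i,j}\alpha_{ij}\log(\alpha_{ij}/p_{ij})$ (with $0\log(0/q)=0$). Let $A$ be a real $s^2\times s^2$ matrix and put $$\lambda=\sup_{\alpha\in\Delta_{s^2}(\pi),\ \alpha\ne p}\frac{(\alpha-p)^TA(\alpha-p)}{D(\alpha,p)}\in[-\infty,\infty]$$ (with $\sup\emptyset=-\infty$). Let $N\sim\mathrm{Multinom}(n,p)$ and $X=(N-np)/\sqrt n$. Let $(a_n)$ be a real sequence with $a_n/\sqrt n\to\infty$ and $a_n/n\to0$, and let $\Omega_n$ be the event that $\left|\sum_iN_{ij}-n\pi_j\right|\le a_n$ for all $j$ and $\left|\sum_jN_{ij}-n\pi_i\right|\le a_n$ for all $i$. Let $Z\sim\mathcal N(0,\mathrm{diag}(p)-pp^T)$. (1) If $\lambda<1$, then $\mathbb E[\mathbf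 1_{\Omega_n}\exp(X^TAX)]\to\mathbb E\exp(Z^TAZ)$ in $[0,\infty]$ as $n\to\infty$. (2) Suppose $\lambda<1$ and the quadratic form of $A$ is insensitive to the marginals: $(x+\pi\otimes u)^TA(x+\pi\otimes u)=x^TAx=(x+u\otimes\pi)^TA(x+u\otimes\pi)$ for all $x\in\mathbb R^{s\times s}$ and $u\in\mathbb R^s$ whose entries sum to zero. (This holds for example if $A=\frac1{2d}B\otimes B$ with $d>0$, $B$ symmetric and $B\pi=0$, as for $B=M-d\mathbf 1\mathbf 1^T$ when $M$ is the matrix of a stochastic block model in which all vertices have the same expected degree $d=\sum_jM_{ij}\pi_j$.) Then $\mathbb E\exp(Z^TAZ)<\infty$, and the variables $\mathbf 1_{\Omega_n}\exp(X^TAX)$, $n\ge0$, are uniformly integrable, that is, $\sup_n\mathbb E[Y_n;Y_n>K]\to0$ as $K\to\infty$ for $Y_n=\mathbf 1_{\Omega_n}\exp(X^TAX)$ (where $X=0$ for $n=0$). (3) If $\lambda>1$, then $\mathbb E[\mathbf 1_{\Omega_n}\exp(X^TAX)]\to\infty$ as $n\to\infty$, and these variables are not uniformly integrable. -/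

import Mathlib

open MeasureTheory ProbabilityTheory Filter Topology
open scoped ENNReal NNReal Matrix

noncomputable section

/-- The multinomial law `Multinom(n, p)` on count vectors: the atom at `r` with `∑ i, r i = n`
has mass `n! / ∏ (r i)! * ∏ (p i) ^ (r i)`. -/
def multinomialLaw {ι : Type*} [Fintype ι] [DecidableEq ι] (n : ℕ) (p : ι → ℝ) :
    Measure (ι → ℕ) :=
  ∑ r ∈ Finset.piAntidiag Finset.univ n,
    ENNReal.ofReal ((Nat.multinomial Finset.univ r : ℝ) * ∏ i, p i ^ r i) • Measure.dirac r

/-- The quadratic form `xᵀ A x`. -/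
def quadForm {ι : Type*} [Fintype ι] (A : Matrix ι ι ℝ) (x : ι → ℝ) : ℝ :=
  x ⬝ᵥ (A *ᵥ x)

/-- The Kullback-Leibler divergence `D(α, p) = ∑ α_i log (α_i / p_i)`. The convention
`0 log (0 / q) = 0` is built in; the formula is only used for `α` vanishing wherever `p` does. -/
def klSum {ι : Type*} [Fintype ι] (α p : ι → ℝ) : ℝ :=
  ∑ i, α i * Real.log (α i / p i)

/-- The product distribution `p = π ⊗ π` on `[s]²`. -/
def prodDist {s : ℕ} (π : Fin s → ℝ) : Fin s × Fin s → ℝ :=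
  fun x => π x.1 * π x.2

/-- `Δ_{s²}(π)`: the probability distributions on `[s]²` both of whose marginals are `π`. -/
def balancedSimplex {s : ℕ} (π : Fin s → ℝ) : Set (Fin s × Fin s → ℝ) :=
  {α | α ∈ stdSimplex ℝ (Fin s × Fin s) ∧
    (∀ j, ∑ i, α (i, j) = π j) ∧ ∀ i, ∑ j, α (i, j) = π i}

/-- The supremum over `α ∈ Δ_{s²}(π)` of `(α - p)ᵀ A (α - p) / D(α, p)`. The point `α = p`, where
the quotient reads `0 / 0`, is left out; the supremum is `-∞` if there is no other point. -/
def ratioSup {s : ℕ} (π : Fin s → ℝ) (A : Matrix (Fin s × Fin s) (Fin s × Fin s) ℝ) : EReal :=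
  ⨆ α ∈ balancedSimplex π \ {prodDist π},
    ((quadForm A (α - prodDist π) / klSum α (prodDist π) : ℝ) : EReal)

/-- The event that all row and column sums of the counts `N` are within `t` of `n π`. -/
def nearlyBalanced {s : ℕ} (π : Fin s → ℝ) (n : ℕ) (t : ℝ) : Set (Fin s × Fin s → ℕ) :=
  {N | (∀ j, |(∑ i, (N (i, j) : ℝ)) - n * π j| ≤ t) ∧
    ∀ i, |(∑ j, (N (i, j) : ℝ)) - n * π i| ≤ t}

/-- The centred and normalized counts `X = (N - n p) / √n`. -/
def centeredCounts {ι : Type*} (p : ι → ℝ) (n : ℕ) (N : ι → ℕ) : ι → ℝ :=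
  fun i => ((N i : ℝ) - n * p i) / √(n : ℝ)

/-- The variable `1_{Ω_n} exp(Xᵀ A X)`, as a function of the counts. -/
def restrictedExp {s : ℕ} (π : Fin s → ℝ) (A : Matrix (Fin s × Fin s) (Fin s × Fin s) ℝ)
    (a : ℕ → ℝ) (n : ℕ) : (Fin s × Fin s → ℕ) → ℝ≥0∞ :=
  (nearlyBalanced π n (a n)).indicator
    fun N => ENNReal.ofReal (Real.exp (quadForm A (centeredCounts (prodDist π) n N)))

/-- `E exp(Zᵀ A Z)` in `[0, ∞]`, for `Z ∼ N(0, diag p - p pᵀ)`. -/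
def gaussianExpMoment {ι : Type*} [Fintype ι] [DecidableEq ι] (p : ι → ℝ) (A : Matrix ι ι ℝ) :
    ℝ≥0∞ :=
  ∫⁻ z, ENNReal.ofReal (Real.exp (quadForm A z.ofLp))
    ∂(multivariateGaussian (0 : EuclideanSpace ℝ ι) (Matrix.diagonal p - Matrix.vecMulVec p p))

/-- Uniform integrability of nonnegative variables `Y n`, each on its own space with law `μ n`:
`sup_n E[Y_n ; Y_n > K] → 0` as `K → ∞`. -/
def UniformlyIntegrableSeq {E : Type*} [MeasurableSpace E] (μ : ℕ → Measure E)
    (Y : ℕ → E → ℝ≥0∞) : Prop :=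
  Tendsto (fun K : ℝ≥0 => ⨆ n, ∫⁻ x in {x | (K : ℝ≥0∞) < Y n x}, Y n x ∂(μ n)) atTop (𝓝 0)

/-- On arrays with total sum zero, the quadratic form of `A` does not change when `π ⊗ u` or
`u ⊗ π` is added, for any `u` with sum zero. -/
def MarginalInvariant {s : ℕ} (π : Fin s → ℝ)
    (A : Matrix (Fin s × Fin s) (Fin s × Fin s) ℝ) : Prop :=
  ∀ (x : Fin s × Fin s → ℝ) (u : Fin s → ℝ), ∑ i, x i = 0 → ∑ i, u i = 0 →
    quadForm A (fun i => x i + π i.1 * u i.2) = quadForm A x ∧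
    quadForm A (fun i => x i + u i.1 * π i.2) = quadForm A x

end

/-! Let `q` be the quadratic form of `A`. At `N = n α` the multinomial mass is `exp (-n D(α, p))` up
to a polynomial factor, and `Xᵀ A X = n q(α - p)`, so the expectation is decided by comparing `q`
with `D` on almost balanced `α`.

Suppose `λ < 1`. Away from `p`, compactness and `a_n / n → 0` give `q + c ≤ D`
(`exists_gap_of_nearlyBalanced`); the polynomially many counts there contribute exponentially
little. Near `p` one needs `q(x) ≤ κ/2 ∑ x_i² / p_i` with `κ < 1` for all sum-zero `x` vanishing
where `p` does, since `Ω_n` leaves room for marginal fluctuations of order `√n`. The Hessian of `D`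
at `p` yields this only for `x` with zero marginals. Marginal invariance extends it by projection
(`quadForm_le_of_marginalInvariant`). Without invariance, finiteness of the Gaussian moment is
itself equivalent to a spectral bound that gives it
(`exists_quadForm_le_of_gaussianExpMoment_ne_top`); if the moment is infinite, the lower bound from
the central limit theorem is all that is needed.

Both bounds together keep the expectations bounded (`exists_bound_lintegral_restrictedExp`). They
survive replacing `A` by `b A` for some `b > 1`, so a moment of order `b` is bounded and the tails
are uniformly small. The central limit theorem for truncated integrands then identifies the limit.

If `λ > 1`, one count vector near `n α`, where `q(α - p) > D(α, p)`, already contributes an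
exponentially large term. -/

/-! ### Quadratic forms and relative entropy -/

section Deterministic

variable {ι : Type*} [Fintype ι]

lemma quadForm_smul (A : Matrix ι ι ℝ) (c : ℝ) (x : ι → ℝ) :
    quadForm A (c • x) = c ^ 2 * quadForm A x := by
  simp only [quadForm, Matrix.mulVec_smul, dotProduct_smul, smul_dotProduct, smul_eq_mul]
  ring

lemma quadForm_smul_matrix (A : Matrix ι ι ℝ) (c : ℝ) (x : ι → ℝ) :
    quadForm (c • A) x = c * quadForm A x := by
  simp [quadForm, Matrix.smul_mulVec]

lemma quadForm_zero (A : Matrix ι ι ℝ) : quadForm A 0 = 0 := by simp [quadForm]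

lemma continuous_quadForm (A : Matrix ι ι ℝ) : Continuous (quadForm A) := by
  unfold quadForm dotProduct Matrix.mulVec dotProduct
  fun_prop

/-- Adding `∑ (p i - α i) = 0` turns the entropy into a sum of nonnegative terms, each vanishing
only at `α i = p i`. -/
lemma klSum_eq_sum_klFun {α p : ι → ℝ} (hsupp : ∀ i, p i = 0 → α i = 0)
    (hsum : ∑ i, α i = ∑ i, p i) :
    klSum α p = ∑ i, p i * InformationTheory.klFun (α i / p i) := by
  have h : ∀ i, p i * InformationTheory.klFun (α i / p i)
      = α i * Real.log (α i / p i) + (p i - α i) := by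
    intro i
    by_cases hp : p i = 0
    · simp [hp, hsupp i hp]
    · rw [InformationTheory.klFun_apply]
      field_simp
      ring
  simp only [h, Finset.sum_add_distrib, Finset.sum_sub_distrib, hsum, sub_self, add_zero, klSum]

lemma klSum_nonneg {α p : ι → ℝ} (hα : ∀ i, 0 ≤ α i) (hp : ∀ i, 0 ≤ p i)
    (hsupp : ∀ i, p i = 0 → α i = 0) (hsum : ∑ i, α i = ∑ i, p i) : 0 ≤ klSum α p := by
  rw [klSum_eq_sum_klFun hsupp hsum]
  exact Finset.sum_nonneg fun i _ => mul_nonneg (hp i)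
    (InformationTheory.klFun_nonneg (div_nonneg (hα i) (hp i)))

lemma klSum_pos {α p : ι → ℝ} (hα : ∀ i, 0 ≤ α i) (hp : ∀ i, 0 ≤ p i)
    (hsupp : ∀ i, p i = 0 → α i = 0) (hsum : ∑ i, α i = ∑ i, p i) (hne : α ≠ p) :
    0 < klSum α p := by
  refine (klSum_nonneg hα hp hsupp hsum).lt_of_ne' fun h0 => hne ?_
  rw [klSum_eq_sum_klFun hsupp hsum, Finset.sum_eq_zero_iff_of_nonneg fun i _ => mul_nonneg (hp i)
    (InformationTheory.klFun_nonneg (div_nonneg (hα i) (hp i)))] at h0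
  ext i
  by_cases hi : p i = 0
  · rw [hi, hsupp i hi]
  · have h1 := (mul_eq_zero.1 (h0 i (Finset.mem_univ i))).resolve_left hi
    rw [InformationTheory.klFun_eq_zero_iff (div_nonneg (hα i) (hp i)), div_eq_one_iff_eq hi] at h1
    exact h1

/-- Each term is a rescaled `t log t`, which is continuous at `0`. Where `p i = 0` the term is
identically zero, because `α i / 0 = 0` and `log 0 = 0`; hence no support condition is needed. -/
lemma continuous_klSum (p : ι → ℝ) : Continuous fun α => klSum α p := by
  unfold klSum
  refine continuous_finsetSum _ fun i _ => ?_
  have h : (fun α : ι → ℝ => α i * Real.log (α i / p i))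
      = fun α => p i * ((α i / p i) * Real.log (α i / p i)) := by
    ext α
    by_cases hp : p i = 0
    · simp [hp]
    · field_simp
  rw [h]
  exact continuous_const.mul (Real.continuous_mul_log.comp ((continuous_apply i).div_const _))

end Deterministic

/-! ### Balanced distributions and the entropy gap -/

section Balanced

variable {s : ℕ} {π : Fin s → ℝ}

lemma prodDist_nonneg (hπ : π ∈ stdSimplex ℝ (Fin s)) (i : Fin s × Fin s) : 0 ≤ prodDist π i :=
  mul_nonneg (hπ.1 _) (hπ.1 _)

lemma sum_prodDist (hπ : π ∈ stdSimplex ℝ (Fin s)) : ∑ i, prodDist π i = 1 := by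
  simp only [prodDist, Fintype.sum_prod_type, ← Finset.mul_sum, hπ.2, mul_one]

lemma prodDist_mem_balancedSimplex (hπ : π ∈ stdSimplex ℝ (Fin s)) :
    prodDist π ∈ balancedSimplex π := by
  refine ⟨⟨prodDist_nonneg hπ, sum_prodDist hπ⟩, fun j => ?_, fun i => ?_⟩
  · simp only [prodDist, ← Finset.sum_mul, hπ.2, one_mul]
  · simp only [prodDist, ← Finset.mul_sum, hπ.2, mul_one]

lemma eq_zero_of_mem_balancedSimplex {α : Fin s × Fin s → ℝ} (hα : α ∈ balancedSimplex π)
    (i : Fin s × Fin s) (hi : prodDist π i = 0) : α i = 0 := by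
  refine le_antisymm ?_ (hα.1.1 i)
  rcases mul_eq_zero.1 hi with h | h
  · rw [← h, ← hα.2.2 i.1]
    exact Finset.single_le_sum (f := fun j => α (i.1, j)) (fun j _ => hα.1.1 _)
      (Finset.mem_univ i.2)
  · rw [← h, ← hα.2.1 i.2]
    exact Finset.single_le_sum (f := fun j => α (j, i.2)) (fun j _ => hα.1.1 _)
      (Finset.mem_univ i.1)

lemma klSum_pos_of_mem_balancedSimplex (hπ : π ∈ stdSimplex ℝ (Fin s))
    {α : Fin s × Fin s → ℝ} (hα : α ∈ balancedSimplex π) (hne : α ≠ prodDist π) :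
    0 < klSum α (prodDist π) :=
  klSum_pos hα.1.1 (prodDist_nonneg hπ) (eq_zero_of_mem_balancedSimplex hα)
    (hα.1.2.trans (sum_prodDist hπ).symm) hne

lemma exists_quadForm_le_of_ratioSup_lt_one (hπ : π ∈ stdSimplex ℝ (Fin s))
    {A : Matrix (Fin s × Fin s) (Fin s × Fin s) ℝ} (h : ratioSup π A < 1) :
    ∃ κ : ℝ, 0 < κ ∧ κ < 1 ∧ ∀ α ∈ balancedSimplex π,
      quadForm A (α - prodDist π) ≤ κ * klSum α (prodDist π) := by
  obtain ⟨r, hr, hr1⟩ := EReal.lt_iff_exists_real_btwn.1 h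
  have hr1' : r < 1 := by exact_mod_cast hr1
  -- The supremum may be negative or `-∞`; the maximum with `1 / 2` makes `κ` positive.
  refine ⟨max r (1 / 2), by positivity, max_lt hr1' (by norm_num), fun α hα => ?_⟩
  by_cases hne : α = prodDist π
  · subst hne
    rw [sub_self, quadForm_zero]
    refine mul_nonneg (by positivity) (klSum_nonneg (prodDist_nonneg hπ) (prodDist_nonneg hπ)
      (fun _ h => h) rfl)
  · have hD := klSum_pos_of_mem_balancedSimplex hπ hα hne
    have h1 : ((quadForm A (α - prodDist π) / klSum α (prodDist π) : ℝ) : EReal) ≤ r :=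
      (le_iSup₂ (f := fun α (_ : α ∈ balancedSimplex π \ {prodDist π}) =>
        ((quadForm A (α - prodDist π) / klSum α (prodDist π) : ℝ) : EReal)) α ⟨hα, hne⟩).trans hr.le
    have h2 : quadForm A (α - prodDist π) / klSum α (prodDist π) ≤ r := by exact_mod_cast h1
    rw [div_le_iff₀ hD] at h2
    exact h2.trans (mul_le_mul_of_nonneg_right (le_max_left _ _) hD.le)

lemma exists_klSum_lt_quadForm_of_one_lt_ratioSup (hπ : π ∈ stdSimplex ℝ (Fin s))
    {A : Matrix (Fin s × Fin s) (Fin s × Fin s) ℝ} (h : 1 < ratioSup π A) :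
    ∃ α ∈ balancedSimplex π, klSum α (prodDist π) < quadForm A (α - prodDist π) := by
  obtain ⟨α, hα⟩ := lt_iSup_iff.1 h
  obtain ⟨⟨hα, hne⟩, hlt⟩ := lt_iSup_iff.1 hα
  refine ⟨α, hα, ?_⟩
  have h2 : 1 < quadForm A (α - prodDist π) / klSum α (prodDist π) := by exact_mod_cast hlt
  rwa [one_lt_div (klSum_pos_of_mem_balancedSimplex hπ hα hne)] at h2

/-- Away from the product distribution, the strict inequality between quadratic form and divergence
on the balanced simplex extends, with a uniform gap, to almost balanced distributions. -/
lemma exists_gap_of_nearlyBalanced (hπ : π ∈ stdSimplex ℝ (Fin s))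
    {A : Matrix (Fin s × Fin s) (Fin s × Fin s) ℝ} {κ : ℝ} (hκ : κ < 1)
    (hA : ∀ α ∈ balancedSimplex π, quadForm A (α - prodDist π) ≤ κ * klSum α (prodDist π))
    {δ : ℝ} (hδ : 0 < δ) :
    ∃ ρ > 0, ∃ c > 0, ∀ α ∈ stdSimplex ℝ (Fin s × Fin s), (∀ i, prodDist π i = 0 → α i = 0) →
      (∀ j, |∑ i, α (i, j) - π j| ≤ ρ) → (∀ i, |∑ j, α (i, j) - π i| ≤ ρ) →
      δ ≤ ‖α - prodDist π‖ → quadForm A (α - prodDist π) + c ≤ klSum α (prodDist π) := by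
  set p := prodDist π with hp
  set m : (Fin s × Fin s → ℝ) → ℝ := fun α =>
    ∑ j, |∑ i, α (i, j) - π j| + ∑ i, |∑ j, α (i, j) - π i| with hm
  set g : (Fin s × Fin s → ℝ) → ℝ := fun α => klSum α p - quadForm A (α - p) with hg
  have hmc : Continuous m := by fun_prop
  have hgc : Continuous g :=
    (continuous_klSum p).sub ((continuous_quadForm A).comp (continuous_id.sub continuous_const))
  have hsc : IsClosed {α : Fin s × Fin s → ℝ | ∀ i, p i = 0 → α i = 0} := by
    simp only [Set.ofPred_forall]
    exact isClosed_iInter fun i => isClosed_iInter fun _ =>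
      isClosed_eq (continuous_apply i) continuous_const
  have hdc : IsClosed {α : Fin s × Fin s → ℝ | δ ≤ ‖α - p‖} :=
    isClosed_le continuous_const (continuous_id.sub continuous_const).norm
  set S := stdSimplex ℝ (Fin s × Fin s) ∩
    ({α | ∀ i, p i = 0 → α i = 0} ∩ {α | δ ≤ ‖α - p‖}) with hS
  have hSc : IsCompact S := (isCompact_stdSimplex ℝ _).inter_right (hsc.inter hdc)
  have hK : IsCompact (S ∩ {α | g α ≤ 0}) := hSc.inter_right (isClosed_le hgc continuous_const)
  have hmn : ∀ α, 0 ≤ m α := fun α => by positivity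
  -- Where `g ≤ 0` the marginal defect `m` cannot vanish, so by compactness it is at least some `ρ₀
  -- > 0`. Hence `g > 0` on the compact set `m ≤ ρ₀ / 2`, and a second compactness argument gives
  -- the gap `c`.
  obtain ⟨ρ₀, hρ₀, hρ⟩ := hK.exists_forall_le' hmc.continuousOn (a := 0) (fun α hα => by
    refine (hmn α).lt_of_ne' fun h0 => ?_
    have h0' := (add_eq_zero_iff_of_nonneg (by positivity) (by positivity)).1 h0
    have h1 : ∀ j, ∑ i, α (i, j) = π j := fun j => by
      have := (Finset.sum_eq_zero_iff_of_nonneg fun j _ => abs_nonneg _).1 h0'.1 j (Finset.mem_univ j)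
      exact sub_eq_zero.1 (abs_eq_zero.1 this)
    have h2 : ∀ i, ∑ j, α (i, j) = π i := fun j => by
      have := (Finset.sum_eq_zero_iff_of_nonneg fun j _ => abs_nonneg _).1 h0'.2 j (Finset.mem_univ j)
      exact sub_eq_zero.1 (abs_eq_zero.1 this)
    have hb : α ∈ balancedSimplex π := ⟨hα.1.1, h1, h2⟩
    have hne : α ≠ p := by
      rintro rfl
      have := hα.1.2.2
      simp only [Set.mem_ofPred_eq, sub_self, norm_zero] at this
      linarith
    have hD := klSum_pos_of_mem_balancedSimplex hπ hb hne
    have h3 := hA α hb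
    have h4 : klSum α p - quadForm A (α - p) ≤ 0 := hα.2
    nlinarith)
  have hL : IsCompact (S ∩ {α | m α ≤ ρ₀ / 2}) := hSc.inter_right (isClosed_le hmc continuous_const)
  obtain ⟨c, hc, hcg⟩ := hL.exists_forall_le' hgc.continuousOn (a := 0) (fun α hα => by
    by_contra! h
    have := hρ α ⟨hα.1, h⟩
    have h2 : m α ≤ ρ₀ / 2 := hα.2
    linarith)
  -- The defect is a sum of `2 s` terms, each at most this number, hence at most `ρ₀ / 2`.
  refine ⟨ρ₀ / (4 * (s + 1)), by positivity, c, hc, fun α hα hs h1 h2 hd => ?_⟩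
  have := hcg α ⟨⟨hα, hs, hd⟩, by
    have e1 : ∑ j, |∑ i, α (i, j) - π j| ≤ s * (ρ₀ / (4 * (s + 1))) := by
      simpa using Finset.sum_le_card_nsmul Finset.univ _ _ fun j _ => h1 j
    have e2 : ∑ i, |∑ j, α (i, j) - π i| ≤ s * (ρ₀ / (4 * (s + 1))) := by
      simpa using Finset.sum_le_card_nsmul Finset.univ _ _ fun j _ => h2 j
    have e3 : (s : ℝ) * (ρ₀ / (4 * (s + 1))) ≤ ρ₀ / 4 := by
      rw [mul_div_assoc', div_le_div_iff₀ (by positivity) (by positivity)]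
      nlinarith
    simp only [Set.mem_ofPred_eq, hm]
    linarith⟩
  simp only [hg] at this
  linarith

end Balanced

/-! ### The quadratic bound from the Hessian of the entropy -/

section Invariant

/-- Second-order Taylor expansion at `1`. Only the coefficient `1 / 2` matters; the cubic term
disappears in the limit `t → 0`. -/
lemma klFun_one_add_le {y : ℝ} (hy : |y| ≤ 1 / 2) :
    InformationTheory.klFun (1 + y) ≤ y ^ 2 / 2 + 4 * |y| ^ 3 := by
  have h := Real.abs_log_sub_add_sum_range_le (x := -y) (by rw [abs_neg]; linarith) 2
  simp only [Finset.sum_range_succ, Finset.sum_range_zero, abs_neg, sub_neg_eq_add] at h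
  have h1 : |y| ^ 3 / (1 - |y|) ≤ 2 * |y| ^ 3 := by
    rw [div_le_iff₀ (by linarith)]
    nlinarith [pow_nonneg (abs_nonneg y) 3]
  have h2 : Real.log (1 + y) ≤ y - y ^ 2 / 2 + 2 * |y| ^ 3 := by
    have := (abs_le.1 h).2
    norm_num at this
    nlinarith
  have hy' := abs_le.1 hy
  have h3 : -y ^ 3 ≤ |y| ^ 3 := by rw [← abs_pow]; exact neg_le_abs _
  rw [InformationTheory.klFun_apply]
  nlinarith [mul_le_mul_of_nonneg_left h2 (by linarith : 0 ≤ 1 + y), pow_nonneg (abs_nonneg y) 3]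

variable {s : ℕ} {π : Fin s → ℝ}

/-- The point `p + t x` is balanced for small `t > 0`. Both sides of `hA` there are of order `t²`;
dividing by `t²` and letting `t → 0` compares `q` with the Hessian of the entropy. -/
lemma quadForm_le_of_marginals_eq_zero (hπ : π ∈ stdSimplex ℝ (Fin s))
    {A : Matrix (Fin s × Fin s) (Fin s × Fin s) ℝ} {κ : ℝ} (hκ : 0 ≤ κ)
    (hA : ∀ α ∈ balancedSimplex π, quadForm A (α - prodDist π) ≤ κ * klSum α (prodDist π))
    {x : Fin s × Fin s → ℝ} (hsupp : ∀ i, prodDist π i = 0 → x i = 0)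
    (h1 : ∀ j, ∑ i, x (i, j) = 0) (h2 : ∀ i, ∑ j, x (i, j) = 0) :
    quadForm A x ≤ κ / 2 * ∑ i, x i ^ 2 / prodDist π i := by
  set p := prodDist π with hp
  set C := ∑ i, |x i| ^ 3 / p i ^ 2
  have hlim : Tendsto (fun t : ℝ => κ * ((∑ i, x i ^ 2 / p i) / 2 + 4 * t * C)) (𝓝[>] 0)
      (𝓝 (κ * ((∑ i, x i ^ 2 / p i) / 2 + 4 * 0 * C))) :=
    (Continuous.tendsto (by fun_prop) 0).mono_left nhdsWithin_le_nhds
  have hsmall : ∀ᶠ t : ℝ in 𝓝[>] 0, ∀ i, |t * (x i / p i)| ≤ 1 / 2 := by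
    refine eventually_all.2 fun i => Eventually.filter_mono nhdsWithin_le_nhds ?_
    have : Tendsto (fun t : ℝ => |t * (x i / p i)|) (𝓝 0) (𝓝 |0 * (x i / p i)|) :=
      Continuous.tendsto (by fun_prop) 0
    simp only [zero_mul, abs_zero] at this
    exact (this.eventually (gt_mem_nhds (by norm_num : (0 : ℝ) < 1 / 2))).mono fun _ h => h.le
  have key : ∀ᶠ t : ℝ in 𝓝[>] 0, quadForm A x ≤ κ * ((∑ i, x i ^ 2 / p i) / 2 + 4 * t * C) := by
    filter_upwards [hsmall, self_mem_nhdsWithin] with t ht ht0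
    have ht0 : 0 < t := ht0
    have hxeq : ∀ i, (p + t • x) i = p i * (1 + t * (x i / p i)) := fun i => by
      by_cases hi : p i = 0
      · simp [hi, hsupp i hi]
      · simp only [Pi.add_apply, Pi.smul_apply, smul_eq_mul]
        field_simp
    have hb : p + t • x ∈ balancedSimplex π := by
      have hpm := prodDist_mem_balancedSimplex hπ
      have e1 : ∀ j, ∑ i, (p + t • x) (i, j) = π j := fun j => by
        simp [Finset.sum_add_distrib, ← Finset.mul_sum, h1, hp, hpm.2.1]
      have e2 : ∀ i, ∑ j, (p + t • x) (i, j) = π i := fun j => by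
        simp [Finset.sum_add_distrib, ← Finset.mul_sum, h2, hp, hpm.2.2]
      refine ⟨⟨fun i => ?_, ?_⟩, e1, e2⟩
      · rw [hxeq]
        exact mul_nonneg (prodDist_nonneg hπ i) (by linarith [(abs_le.1 (ht i)).1])
      · rw [Fintype.sum_prod_type]
        simp only [e2, hπ.2]
    have h3 := hA _ hb
    rw [add_sub_cancel_left, quadForm_smul, klSum_eq_sum_klFun
      (eq_zero_of_mem_balancedSimplex hb) (hb.1.2.trans (sum_prodDist hπ).symm)] at h3
    have h4 : ∑ i, p i * InformationTheory.klFun ((p + t • x) i / p i)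
        ≤ t ^ 2 * ((∑ i, x i ^ 2 / p i) / 2 + 4 * t * C) := by
      rw [Finset.sum_div, Finset.mul_sum, ← Finset.sum_add_distrib, Finset.mul_sum]
      refine Finset.sum_le_sum fun i _ => ?_
      by_cases hi : p i = 0
      · simp [hi]
      have hpi : 0 < p i := (prodDist_nonneg hπ i).lt_of_ne' hi
      rw [hxeq, mul_div_cancel_left₀ _ hi]
      refine (mul_le_mul_of_nonneg_left (klFun_one_add_le (ht i)) hpi.le).trans (le_of_eq ?_)
      rw [abs_mul, abs_div, abs_of_pos hpi, abs_of_pos ht0]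
      field_simp
    have h5 := h3.trans (mul_le_mul_of_nonneg_left h4 hκ)
    have ht2 : 0 < t ^ 2 := by positivity
    refine le_of_mul_le_mul_left (h5.trans (le_of_eq ?_)) ht2
    ring
  refine (ge_of_tendsto hlim key).trans (le_of_eq ?_)
  ring

/-- Removing the marginals of `x` leaves `q` unchanged and does not increase `∑ x_i² / p_i`, since
the removed part is orthogonal to the remainder for the weights `1 / p_i`. -/
lemma quadForm_le_of_marginalInvariant (hπ : π ∈ stdSimplex ℝ (Fin s))
    {A : Matrix (Fin s × Fin s) (Fin s × Fin s) ℝ} {κ : ℝ} (hκ : 0 ≤ κ)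
    (hA : ∀ α ∈ balancedSimplex π, quadForm A (α - prodDist π) ≤ κ * klSum α (prodDist π))
    (hinv : MarginalInvariant π A)
    {x : Fin s × Fin s → ℝ} (hsupp : ∀ i, prodDist π i = 0 → x i = 0) (hsum : ∑ i, x i = 0) :
    quadForm A x ≤ κ / 2 * ∑ i, x i ^ 2 / prodDist π i := by
  set u : Fin s → ℝ := fun j => ∑ i, x (i, j) with hu
  set v : Fin s → ℝ := fun i => ∑ j, x (i, j) with hv
  have hu0 : ∑ j, u j = 0 := by rw [← hsum, Fintype.sum_prod_type_right]
  have hv0 : ∑ i, v i = 0 := by rw [← hsum, Fintype.sum_prod_type]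
  set y : Fin s × Fin s → ℝ := fun i => x i - π i.1 * u i.2 - v i.1 * π i.2 with hy
  have hy1 : ∀ j, ∑ i, y (i, j) = 0 := fun j => by
    simp only [hy, Finset.sum_sub_distrib, ← Finset.sum_mul, hπ.2, hv0, hu]
    ring
  have hy2 : ∀ i, ∑ j, y (i, j) = 0 := fun i => by
    simp only [hy, Finset.sum_sub_distrib, ← Finset.mul_sum, hπ.2, hu0, hv]
    ring
  have hy0 : ∑ i, y i = 0 := by rw [Fintype.sum_prod_type]; simp [hy2]
  have hu' : ∀ j, π j = 0 → u j = 0 := fun j hj =>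
    Finset.sum_eq_zero fun i _ => hsupp _ (by simp [prodDist, hj])
  have hv' : ∀ i, π i = 0 → v i = 0 := fun i hi =>
    Finset.sum_eq_zero fun j _ => hsupp _ (by simp [prodDist, hi])
  have hys : ∀ i, prodDist π i = 0 → y i = 0 := fun i hi => by
    have hx := hsupp i hi
    rcases mul_eq_zero.1 hi with h | h
    · simp [hy, hx, h, hv' _ h]
    · simp [hy, hx, h, hu' _ h]
  have hz0 : ∑ i, (y i + v i.1 * π i.2) = 0 := by
    rw [Finset.sum_add_distrib, hy0, Fintype.sum_prod_type]
    simp [← Finset.mul_sum, hπ.2, hv0]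
  have hq : quadForm A x = quadForm A y := by
    rw [← (hinv y v hy0 hv0).2, ← (hinv _ u hz0 hu0).1]
    congr 1
    ext i
    simp only [hy]
    ring
  rw [hq]
  refine (quadForm_le_of_marginals_eq_zero hπ hκ hA hys hy1 hy2).trans
    (mul_le_mul_of_nonneg_left ?_ (by positivity))
  -- Orthogonality: `y` has zero marginals, and the other factor is a function of the column plus a
  -- function of the row.
  have hcross : ∑ i, y i * (u i.2 / π i.2 + v i.1 / π i.1) = 0 := by
    simp only [mul_add, Finset.sum_add_distrib]
    rw [Fintype.sum_prod_type_right, Fintype.sum_prod_type]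
    simp [← Finset.sum_mul, hy1, hy2]
  -- Expanding the square of `x = y + p w` leaves the nonnegative excess `p w²`.
  have hle : ∀ i, y i ^ 2 / prodDist π i + 2 * (y i * (u i.2 / π i.2 + v i.1 / π i.1))
      ≤ x i ^ 2 / prodDist π i := fun i => by
    by_cases hi : prodDist π i = 0
    · simp [hys i hi, hi]
    · have hpos : 0 < prodDist π i := (prodDist_nonneg hπ i).lt_of_ne' hi
      obtain ⟨h1, h2⟩ := mul_ne_zero_iff.1 hi
      have hx : x i = y i + prodDist π i * (u i.2 / π i.2 + v i.1 / π i.1) := by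
        simp only [hy, prodDist]
        field_simp
        ring
      rw [hx]
      generalize u i.2 / π i.2 + v i.1 / π i.1 = w
      rw [← sub_nonneg]
      have : (y i + prodDist π i * w) ^ 2 / prodDist π i - (y i ^ 2 / prodDist π i + 2 * (y i * w))
          = prodDist π i * w ^ 2 := by
        field_simp
        ring
      rw [this]
      positivity
  have := Finset.sum_le_sum fun i (_ : i ∈ Finset.univ) => hle i
  rw [Finset.sum_add_distrib, ← Finset.mul_sum, hcross] at this
  linarith

end Invariant

/-! ### Multinomial masses and entropy -/

section Multinomial

variable {ι : Type*} [Fintype ι]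

/-- The mass which the multinomial law with parameter `p` gives to the count vector `r`. -/
noncomputable def multinomialMass (p : ι → ℝ) (r : ι → ℕ) : ℝ :=
  (Nat.multinomial Finset.univ r : ℝ) * ∏ i, p i ^ r i

lemma multinomialMass_nonneg {p : ι → ℝ} (hp : ∀ i, 0 ≤ p i) (r : ι → ℕ) :
    0 ≤ multinomialMass p r :=
  mul_nonneg (Nat.cast_nonneg _) (Finset.prod_nonneg fun i _ => pow_nonneg (hp i) _)

lemma multinomialMass_eq_zero {p : ι → ℝ} {r : ι → ℕ} {i : ι} (hp : p i = 0) (hr : r i ≠ 0) :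
    multinomialMass p r = 0 := by
  rw [multinomialMass, Finset.prod_eq_zero (Finset.mem_univ i) (by rw [hp, zero_pow hr]), mul_zero]

lemma sum_multinomialMass [DecidableEq ι] (p : ι → ℝ) (n : ℕ) :
    ∑ r ∈ Finset.piAntidiag Finset.univ n, multinomialMass p r = (∑ i, p i) ^ n := by
  rw [Finset.sum_pow_eq_sum_piAntidiag]
  rfl

lemma sum_multinomialMass_mul_exp [DecidableEq ι] (p θ : ι → ℝ) (n : ℕ) :
    ∑ r ∈ Finset.piAntidiag Finset.univ n, multinomialMass p r * Real.exp (∑ i, θ i * r i)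
      = (∑ i, p i * Real.exp (θ i)) ^ n := by
  rw [Finset.sum_pow_eq_sum_piAntidiag]
  refine Finset.sum_congr rfl fun r _ => ?_
  rw [multinomialMass, Real.exp_sum, mul_assoc, ← Finset.prod_mul_distrib]
  congr 1
  refine Finset.prod_congr rfl fun i _ => ?_
  rw [mul_pow, ← Real.exp_nat_mul, mul_comm (θ i)]

lemma lintegral_multinomialLaw [DecidableEq ι] (n : ℕ) (p : ι → ℝ) (f : (ι → ℕ) → ℝ≥0∞) :
    ∫⁻ N, f N ∂(multinomialLaw n p)
      = ∑ r ∈ Finset.piAntidiag Finset.univ n, ENNReal.ofReal (multinomialMass p r) * f r := by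
  simp only [multinomialLaw, lintegral_finsetSum_measure, lintegral_smul_measure, lintegral_dirac,
    smul_eq_mul, multinomialMass]

lemma natCast_sum_eq_of_mem_piAntidiag [DecidableEq ι] {n : ℕ} {r : ι → ℕ}
    (hr : r ∈ Finset.piAntidiag Finset.univ n) : ∑ i, (r i : ℝ) = n := by
  rw [← (Finset.mem_piAntidiag.1 hr).1]
  push_cast
  rfl

lemma card_piAntidiag_le [DecidableEq ι] (n : ℕ) :
    (Finset.piAntidiag (Finset.univ : Finset ι) n).card ≤ (n + 1) ^ Fintype.card ι := by
  have h : Finset.piAntidiag (Finset.univ : Finset ι) n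
      ⊆ Fintype.piFinset fun _ => Finset.range (n + 1) := fun r hr => by
    rw [Fintype.mem_piFinset]
    intro i
    rw [Finset.mem_range, Nat.lt_succ_iff, ← (Finset.mem_piAntidiag.1 hr).1]
    exact Finset.single_le_sum (fun _ _ => Nat.zero_le _) (Finset.mem_univ i)
  refine (Finset.card_le_card h).trans (le_of_eq ?_)
  simp [Fintype.card_piFinset]

/-- The product of the powers `p i ^ r i`, written through the empirical distribution `r / n`. -/
lemma prod_pow_eq_mul_exp_klSum {p : ι → ℝ} (hp : ∀ i, 0 ≤ p i) {n : ℕ} (hn : 0 < n) {r : ι → ℕ}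
    (hsupp : ∀ i, p i = 0 → r i = 0) :
    ∏ i, p i ^ r i = (∏ i, ((r i : ℝ) / n) ^ r i) *
      Real.exp (-(n * klSum (fun i => (r i : ℝ) / n) p)) := by
  rw [klSum, Finset.mul_sum, ← Finset.sum_neg_distrib, Real.exp_sum, ← Finset.prod_mul_distrib]
  refine Finset.prod_congr rfl fun i _ => ?_
  have hn' : (0 : ℝ) < n := by exact_mod_cast hn
  rcases Nat.eq_zero_or_pos (r i) with hr | hr
  · simp [hr]
  have hr' : (0 : ℝ) < r i := by exact_mod_cast hr
  have hpi : 0 < p i := (hp i).lt_of_ne' fun h => hr.ne' (hsupp i h)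
  have e : -((n : ℝ) * ((r i : ℝ) / n * Real.log ((r i : ℝ) / n / p i)))
      = r i * Real.log (p i / ((r i : ℝ) / n)) := by
    rw [← inv_div (p i) ((r i : ℝ) / n), Real.log_inv]
    field_simp
  rw [e, Real.exp_nat_mul, Real.exp_log (by positivity), ← mul_pow]
  congr 1
  field_simp

/-- Changing the parameter from `p` to the empirical distribution `r / n` produces exactly the
factor `exp (-n D)`, and a single mass under the new parameter is at most `1`. -/
lemma multinomialMass_le_exp_neg_klSum [DecidableEq ι] {p : ι → ℝ} (hp : ∀ i, 0 ≤ p i) {n : ℕ} (hn : 0 < n)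
    {r : ι → ℕ} (hr : r ∈ Finset.piAntidiag Finset.univ n) (hsupp : ∀ i, p i = 0 → r i = 0) :
    multinomialMass p r ≤ Real.exp (-(n * klSum (fun i => (r i : ℝ) / n) p)) := by
  have hq : ∀ i, 0 ≤ (r i : ℝ) / n := fun i => by positivity
  have h1 : multinomialMass (fun i => (r i : ℝ) / n) r ≤ 1 := by
    have := Finset.single_le_sum (fun r _ => multinomialMass_nonneg hq r) hr
    refine this.trans (le_of_eq ?_)
    rw [sum_multinomialMass, ← Finset.sum_div, natCast_sum_eq_of_mem_piAntidiag hr,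
      div_self (by positivity), one_pow]
  rw [multinomialMass, prod_pow_eq_mul_exp_klSum hp hn hsupp, ← mul_assoc]
  exact mul_le_of_le_one_left (Real.exp_nonneg _) h1

lemma factorial_le_mul_exp (k : ℕ) :
    (k.factorial : ℝ) ≤ Real.exp 1 * (k + 1) * ((k : ℝ) ^ k * Real.exp (-k)) := by
  -- With the index shifted, the factor `k + 1` merges with `(k + 1) ^ (k + 1)`, so that the
  -- induction reduces to `e (k + 1) ^ (k + 2) ≤ (k + 2) ^ (k + 2)`.
  have key : ∀ k : ℕ, ((k + 1).factorial : ℝ)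
      ≤ Real.exp 1 * (k + 1) * (((k + 1 : ℕ) : ℝ) ^ (k + 1) * Real.exp (-((k + 1 : ℕ) : ℝ))) := by
    intro k
    induction k with
    | zero => simp [← Real.exp_add]
    | succ k ih =>
      rw [Nat.factorial_succ, Nat.cast_mul]
      refine (mul_le_mul_of_nonneg_left ih (Nat.cast_nonneg _)).trans ?_
      have h1 : Real.exp 1 * ((k + 1 : ℕ) : ℝ) ^ (k + 2) ≤ ((k + 2 : ℕ) : ℝ) ^ (k + 2) := by
        have hx : (0 : ℝ) < ((k + 1 : ℕ) : ℝ) / ((k + 2 : ℕ) : ℝ) := by positivity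
        have h2 : ((k + 1 : ℕ) : ℝ) / ((k + 2 : ℕ) : ℝ) ≤ Real.exp (-1 / ((k + 2 : ℕ) : ℝ)) := by
          have := Real.add_one_le_exp (-1 / ((k + 2 : ℕ) : ℝ))
          refine le_trans (le_of_eq ?_) this
          push_cast
          field_simp
          ring
        have h3 := pow_le_pow_left₀ hx.le h2 (k + 2)
        rw [← Real.exp_nat_mul, div_pow, div_le_iff₀ (by positivity)] at h3
        have h4 : ((k + 2 : ℕ) : ℝ) * (-1 / ((k + 2 : ℕ) : ℝ)) = -1 := by field_simp
        rw [h4] at h3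
        calc _ ≤ Real.exp 1 * (Real.exp (-1) * ((k + 2 : ℕ) : ℝ) ^ (k + 2)) := by gcongr
          _ = _ := by rw [← mul_assoc, ← Real.exp_add]; simp
      have h5 : Real.exp (-((k + 1 : ℕ) : ℝ)) = Real.exp 1 * Real.exp (-((k + 2 : ℕ) : ℝ)) := by
        rw [← Real.exp_add]
        congr 1
        push_cast
        ring
      rw [h5]
      push_cast at h1 ⊢
      calc _ = Real.exp 1 * ((k : ℝ) + 1 + 1) * (Real.exp 1 * ((k : ℝ) + 1) ^ (k + 2)
            * Real.exp (-((k : ℝ) + 2))) := by ring_nf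
        _ ≤ Real.exp 1 * ((k : ℝ) + 1 + 1) * (((k : ℝ) + 2) ^ (k + 2)
            * Real.exp (-((k : ℝ) + 2))) := by gcongr
        _ = _ := by ring_nf
  rcases k with _ | k
  · simp
  · refine (key k).trans ?_
    push_cast
    gcongr
    linarith

/-- The multinomial mass is at least `exp (- n D)` up to a polynomial factor. -/
lemma exp_neg_klSum_le_multinomialMass [DecidableEq ι] {p : ι → ℝ} (hp : ∀ i, 0 ≤ p i) {n : ℕ} (hn : 0 < n)
    {r : ι → ℕ} (hr : r ∈ Finset.piAntidiag Finset.univ n) (hsupp : ∀ i, p i = 0 → r i = 0) :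
    Real.exp (-(n * klSum (fun i => (r i : ℝ) / n) p))
      ≤ (Real.exp 1 * (n + 1)) ^ Fintype.card ι * multinomialMass p r := by
  have hn' : (0 : ℝ) < n := by exact_mod_cast hn
  rw [multinomialMass, prod_pow_eq_mul_exp_klSum hp hn hsupp, ← mul_assoc, ← mul_assoc]
  refine le_mul_of_one_le_left (Real.exp_nonneg _) ?_
  have hsum := natCast_sum_eq_of_mem_piAntidiag hr
  have hfac : (∏ i, ((r i).factorial : ℝ)) * (Nat.multinomial Finset.univ r : ℝ)
      = (n.factorial : ℝ) := by
    have := Nat.multinomial_spec Finset.univ r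
    rw [(Finset.mem_piAntidiag.1 hr).1] at this
    exact_mod_cast this
  have hprod : (∏ i, ((r i).factorial : ℝ))
      ≤ (Real.exp 1 * (n + 1)) ^ Fintype.card ι * ((∏ i, (r i : ℝ) ^ r i) * Real.exp (-n)) := by
    calc (∏ i, ((r i).factorial : ℝ))
        ≤ ∏ i, (Real.exp 1 * (n + 1) * ((r i : ℝ) ^ r i * Real.exp (-(r i : ℝ)))) := by
          refine Finset.prod_le_prod (fun i _ => by positivity) fun i _ => ?_
          refine (factorial_le_mul_exp (r i)).trans ?_
          have : (r i : ℝ) ≤ n := by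
            rw [← hsum]
            exact Finset.single_le_sum (f := fun i => (r i : ℝ)) (fun _ _ => Nat.cast_nonneg _)
              (Finset.mem_univ i)
          gcongr
      _ = _ := by
          simp only [Finset.prod_mul_distrib, Finset.prod_const, ← Real.exp_sum,
            Finset.sum_neg_distrib, hsum, Finset.card_univ, mul_pow]
  have hnf : (n : ℝ) ^ n * Real.exp (-n) ≤ n.factorial := by
    have := Real.pow_div_factorial_le_exp (n : ℝ) hn'.le n
    rw [div_le_iff₀ (by positivity)] at this
    calc _ ≤ Real.exp n * n.factorial * Real.exp (-n) := by gcongr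
      _ = _ := by rw [mul_right_comm, ← Real.exp_add]; simp
  have hpow : ∏ i, ((r i : ℝ) / n) ^ r i = (∏ i, (r i : ℝ) ^ r i) / (n : ℝ) ^ n := by
    simp only [div_pow, Finset.prod_div_distrib, Finset.prod_pow_eq_pow_sum]
    rw [(Finset.mem_piAntidiag.1 hr).1]
  have hfpos : (0 : ℝ) < ∏ i, ((r i).factorial : ℝ) := Finset.prod_pos fun i _ => by positivity
  -- The factor `∏ (r i)!` is kept on both sides and cancelled afterwards, which avoids dividing by
  -- it.
  have hfin : (∏ i, ((r i).factorial : ℝ)) * ((n : ℝ) ^ n * Real.exp (-n))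
      ≤ (∏ i, ((r i).factorial : ℝ)) * ((Real.exp 1 * (n + 1)) ^ Fintype.card ι *
        (Nat.multinomial Finset.univ r : ℝ) * (∏ i, (r i : ℝ) ^ r i) * Real.exp (-n)) := by
    calc _ ≤ (Real.exp 1 * (n + 1)) ^ Fintype.card ι * ((∏ i, (r i : ℝ) ^ r i) * Real.exp (-n))
          * n.factorial := by
            gcongr
      _ = _ := by rw [← hfac]; ring
  have h2 := le_of_mul_le_mul_right ((le_of_mul_le_mul_left hfin hfpos)) (Real.exp_pos _)
  rw [hpow, mul_div_assoc', one_le_div (by positivity)]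
  exact h2

end Multinomial

/-! ### Exponential moments near the mean -/

section NearBound

/-- Linearizes the square so that the moment generating function applies: `κ y² / 2` is the maximum
over real `t` of `t y - t² / (2 κ)`, attained at `t = κ y`. Rounding `t` down to an integer costs at
most `1 / (2 κ)`. -/
lemma exp_half_sq_le {κ : ℝ} (hκ : 0 < κ) {y : ℝ} {M : ℕ} (hM : κ * |y| + 1 ≤ M) :
    Real.exp (κ / 2 * y ^ 2) ≤ Real.exp (1 / (2 * κ)) *
      ∑ t ∈ Finset.Icc (-(M : ℤ)) M, Real.exp (t * y - (t : ℝ) ^ 2 / (2 * κ)) := by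
  have hmem : ⌊κ * y⌋ ∈ Finset.Icc (-(M : ℤ)) M := by
    have h1 := Int.floor_le (κ * y)
    have h2 := Int.lt_floor_add_one (κ * y)
    have h3 : |κ * y| ≤ M - 1 := by
      rw [abs_mul, abs_of_pos hκ]
      linarith
    have h4 := abs_le.1 h3
    rw [Finset.mem_Icc]
    constructor
    · have : -(M : ℝ) ≤ (⌊κ * y⌋ : ℝ) := by linarith
      exact_mod_cast this
    · have : (⌊κ * y⌋ : ℝ) ≤ M := by linarith
      exact_mod_cast this
  refine le_trans ?_ (mul_le_mul_of_nonneg_left (Finset.single_le_sum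
    (f := fun t : ℤ => Real.exp (t * y - (t : ℝ) ^ 2 / (2 * κ)))
    (fun _ _ => Real.exp_nonneg _) hmem) (Real.exp_nonneg _))
  rw [← Real.exp_add, Real.exp_le_exp]
  have h1 := Int.floor_le (κ * y)
  have h2 := Int.lt_floor_add_one (κ * y)
  generalize (⌊κ * y⌋ : ℝ) = t at h1 h2
  have h3 : (κ * y - t) ^ 2 ≤ 1 := by nlinarith
  have h4 : 1 / (2 * κ) + (t * y - t ^ 2 / (2 * κ)) - κ / 2 * y ^ 2
      = (1 - (κ * y - t) ^ 2) / (2 * κ) := by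
    field_simp
    ring
  have h5 : 0 ≤ (1 - (κ * y - t) ^ 2) / (2 * κ) := div_nonneg (by linarith) (by positivity)
  linarith

lemma exists_sum_exp_neg_sq_le {c : ℝ} (hc : 0 < c) :
    ∃ S : ℝ, ∀ M : ℕ, ∑ t ∈ Finset.Icc (-(M : ℤ)) M, Real.exp (-(c * (t : ℝ) ^ 2)) ≤ S := by
  have hs : Summable fun t : ℤ => Real.exp (-(c * (t : ℝ) ^ 2)) := by
    have hnat : Summable fun n : ℕ => Real.exp (-(c * (n : ℝ) ^ 2)) := by
      refine Summable.of_nonneg_of_le (fun _ => Real.exp_nonneg _) (fun n => ?_)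
        (summable_geometric_of_lt_one (Real.exp_nonneg (-c)) (by rw [← Real.exp_zero, Real.exp_lt_exp]; linarith))
      rw [← Real.exp_nat_mul, Real.exp_le_exp]
      have : (n : ℝ) ≤ (n : ℝ) ^ 2 := by exact_mod_cast Nat.le_self_pow two_ne_zero n
      nlinarith
    refine Summable.of_nat_of_neg ?_ ?_ <;> simpa using hnat
  exact ⟨_, fun M => hs.sum_le_tsum _ fun _ _ => Real.exp_nonneg _⟩

lemma exists_exp_le_quadratic {ε : ℝ} (hε : 0 < ε) :
    ∃ τ > 0, ∀ θ : ℝ, |θ| ≤ τ → Real.exp θ ≤ 1 + θ + (1 + ε) / 2 * θ ^ 2 := by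
  refine ⟨min 1 (ε / 2), by positivity, fun θ hθ => ?_⟩
  have h1 : |θ| ≤ 1 := hθ.trans (min_le_left _ _)
  have h2 : |θ| ≤ ε / 2 := hθ.trans (min_le_right _ _)
  have h := (abs_le.1 (Real.exp_bound h1 (n := 3) (by norm_num))).2
  norm_num [Finset.sum_range_succ, Nat.factorial] at h
  have h3 : |θ| ^ 3 ≤ ε / 2 * θ ^ 2 := by
    rw [pow_succ' |θ|, sq_abs]
    gcongr
  nlinarith [pow_nonneg (abs_nonneg θ) 3]

variable {ι : Type*} [Fintype ι] [DecidableEq ι]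

/-- The base of the generating function is bounded by `1 + u ≤ exp u`; the centring cancels the
linear part of `u`. -/
lemma sum_multinomialMass_mul_exp_centered_le {p : ι → ℝ} (hp : ∀ i, 0 ≤ p i)
    (hsum : ∑ i, p i = 1) {ε : ℝ} {θ : ι → ℝ}
    (hθ : ∀ i, Real.exp (θ i) ≤ 1 + θ i + (1 + ε) / 2 * θ i ^ 2) (n : ℕ) :
    ∑ r ∈ Finset.piAntidiag Finset.univ n,
        multinomialMass p r * Real.exp (∑ i, θ i * (r i - n * p i))
      ≤ Real.exp ((1 + ε) / 2 * (n * ∑ i, p i * θ i ^ 2)) := by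
  have h1 : ∑ i, p i * Real.exp (θ i)
      ≤ Real.exp (∑ i, p i * θ i + (1 + ε) / 2 * ∑ i, p i * θ i ^ 2) := by
    refine le_trans ?_ (Real.add_one_le_exp _)
    calc ∑ i, p i * Real.exp (θ i) ≤ ∑ i, p i * (1 + θ i + (1 + ε) / 2 * θ i ^ 2) :=
          Finset.sum_le_sum fun i _ => mul_le_mul_of_nonneg_left (hθ i) (hp i)
      _ = _ := by
          have e : ∀ i, p i * (1 + θ i + (1 + ε) / 2 * θ i ^ 2)
              = p i + p i * θ i + (1 + ε) / 2 * (p i * θ i ^ 2) := fun i => by ring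
          simp only [e, Finset.sum_add_distrib, ← Finset.mul_sum, hsum]
          ring
  have h2 : ∀ r : ι → ℕ, multinomialMass p r * Real.exp (∑ i, θ i * (r i - n * p i))
      = multinomialMass p r * Real.exp (∑ i, θ i * r i) * Real.exp (-(n * ∑ i, p i * θ i)) := by
    intro r
    rw [mul_assoc, ← Real.exp_add, Finset.mul_sum, ← Finset.sum_neg_distrib,
      ← Finset.sum_add_distrib]
    congr 2
    exact Finset.sum_congr rfl fun i _ => by ring
  simp only [h2]
  rw [← Finset.sum_mul, sum_multinomialMass_mul_exp]
  have h3 : (∑ i, p i * Real.exp (θ i)) ^ n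
      ≤ Real.exp (∑ i, p i * θ i + (1 + ε) / 2 * ∑ i, p i * θ i ^ 2) ^ n :=
    pow_le_pow_left₀ (Finset.sum_nonneg fun i _ => mul_nonneg (hp i) (Real.exp_nonneg _)) h1 n
  refine (mul_le_mul_of_nonneg_right h3 (Real.exp_nonneg _)).trans (le_of_eq ?_)
  rw [← Real.exp_nat_mul, ← Real.exp_add]
  congr 1
  ring

/-- Near the mean, Gaussian-type exponential moments of subcritical order are bounded uniformly. -/
lemma exists_bound_sum_multinomialMass_near {p : ι → ℝ} (hp : ∀ i, 0 ≤ p i)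
    (hsum : ∑ i, p i = 1) {κ : ℝ} (hκ : 0 < κ) (hκ1 : κ < 1) :
    ∃ δ > 0, ∃ C : ℝ, ∀ᶠ n : ℕ in atTop,
      ∑ r ∈ (Finset.piAntidiag Finset.univ n).filter (fun r => ∀ i, |(r i : ℝ) / n - p i| ≤ δ),
        multinomialMass p r * Real.exp (κ / 2 * ∑ i, centeredCounts p n r i ^ 2 / p i) ≤ C := by
  -- Here `(1 + ε) / 2 = 1 / (2 κ) - c` with the `c` below, so the penalty `t² / (2 κ)` beats the
  -- generating function by `c t²`.
  set ε := (1 / κ - 1) / 2 with hεdef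
  have hκ' : 1 < 1 / κ := by rwa [one_lt_div hκ]
  have hε : 0 < ε := by linarith
  set c := (1 / κ - 1) / 4 with hcdef
  have hc : 0 < c := by linarith
  obtain ⟨S, hS⟩ := exists_sum_exp_neg_sq_le hc
  obtain ⟨τ, hτ, hexp⟩ := exists_exp_le_quadratic hε
  -- Indices with `p i = 0` contribute `0⁻¹ = 0`.
  set B := 1 + ∑ i, (√(p i))⁻¹ with hB
  have hBi : ∀ i, (√(p i))⁻¹ ≤ B := fun i => by
    have := Finset.single_le_sum (f := fun i => (√(p i))⁻¹) (fun i _ => by positivity)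
      (Finset.mem_univ i)
    linarith
  have hB1 : 1 ≤ B := by
    have : 0 ≤ ∑ i, (√(p i))⁻¹ := Finset.sum_nonneg fun i _ => by positivity
    linarith
  have hBpos : 0 < B := by linarith
  -- For `|t| ≤ M` the tilt `t / √(n p_i)` must not exceed `τ`: this `δ` uses up one half of `τ`,
  -- and the rounding in `M` the other half once `√n ≥ 4 B / τ`.
  set δ := τ / (2 * B ^ 2) with hδ
  have hδpos : 0 < δ := by positivity
  refine ⟨δ, hδpos, (Real.exp (1 / (2 * κ))) ^ Fintype.card ι * S ^ Fintype.card ι, ?_⟩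
  have hlarge : ∀ᶠ n : ℕ in atTop, 4 * B / τ ≤ √(n : ℝ) :=
    (Real.tendsto_sqrt_atTop.comp tendsto_natCast_atTop_atTop).eventually_ge_atTop _
  filter_upwards [hlarge, eventually_gt_atTop 0] with n hn hn0
  have hn0' : (0 : ℝ) < n := by exact_mod_cast hn0
  have hsn : 0 < √(n : ℝ) := Real.sqrt_pos.2 hn0'
  set M : ℕ := ⌈B * δ * √(n : ℝ)⌉₊ + 1 with hM
  have hM1 : B * δ * √(n : ℝ) + 1 ≤ M := by
    have := Nat.le_ceil (B * δ * √(n : ℝ))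
    push_cast [hM]
    linarith
  have hM2 : (M : ℝ) ≤ B * δ * √(n : ℝ) + 2 := by
    have := Nat.ceil_lt_add_one (show 0 ≤ B * δ * √(n : ℝ) by positivity)
    push_cast [hM]
    linarith
  set T : Finset (ι → ℤ) := Fintype.piFinset fun _ => Finset.Icc (-(M : ℤ)) M with hT
  set y : (ι → ℕ) → ι → ℝ := fun r i => centeredCounts p n r i * (√(p i))⁻¹ with hy
  have hysq : ∀ r i, centeredCounts p n r i ^ 2 / p i = y r i ^ 2 := fun r i => by
    rw [hy, mul_pow, inv_pow, Real.sq_sqrt (hp i), div_eq_mul_inv]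
  have hpt : ∀ r : ι → ℕ, (∀ i, |(r i : ℝ) / n - p i| ≤ δ) →
      Real.exp (κ / 2 * ∑ i, centeredCounts p n r i ^ 2 / p i)
        ≤ Real.exp (1 / (2 * κ)) ^ Fintype.card ι * ∑ t ∈ T,
          ∏ i, Real.exp (t i * y r i - (t i : ℝ) ^ 2 / (2 * κ)) := by
    intro r hr
    simp only [hysq]
    rw [Finset.mul_sum, Real.exp_sum, hT,
      ← Finset.prod_univ_sum (fun _ : ι => Finset.Icc (-(M : ℤ)) M)
        fun i t => Real.exp ((t : ℝ) * y r i - (t : ℝ) ^ 2 / (2 * κ)),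
      ← Finset.card_univ, ← Finset.prod_const, ← Finset.prod_mul_distrib]
    refine Finset.prod_le_prod (fun _ _ => Real.exp_nonneg _) fun i _ => exp_half_sq_le hκ ?_
    have h1 : centeredCounts p n r i = ((r i : ℝ) / n - p i) * √(n : ℝ) := by
      rw [centeredCounts, div_eq_iff hsn.ne', mul_assoc, Real.mul_self_sqrt hn0'.le]
      field_simp
    have h2 : |y r i| ≤ B * δ * √(n : ℝ) := by
      rw [hy]
      simp only
      rw [h1, abs_mul, abs_mul, abs_of_pos hsn, abs_of_nonneg (by positivity : 0 ≤ (√(p i))⁻¹)]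
      calc _ ≤ δ * √(n : ℝ) * B := by gcongr; exacts [hr i, hBi i]
        _ = _ := by ring
    nlinarith [abs_nonneg (y r i)]
  -- For fixed `t`, this is the generating function at `θ_i = t_i / √(n p_i)`, where `n ∑ p_i θ_i²`
  -- is at most `∑ t_i²`.
  have hmgf : ∀ t ∈ T, ∑ r ∈ Finset.piAntidiag Finset.univ n,
      multinomialMass p r * Real.exp (∑ i, t i * y r i)
        ≤ Real.exp ((1 + ε) / 2 * ∑ i, (t i : ℝ) ^ 2) := by
    intro t ht
    have hθ : ∀ i, |(t i : ℝ) * (√(p i))⁻¹ / √(n : ℝ)| ≤ τ := fun i => by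
      have ht1 := Finset.mem_Icc.1 (Fintype.mem_piFinset.1 ht i)
      have ht2 : |(t i : ℝ)| ≤ M := by
        rw [abs_le]
        exact ⟨by exact_mod_cast ht1.1, by exact_mod_cast ht1.2⟩
      rw [abs_div, abs_mul, abs_of_pos hsn, abs_of_nonneg (by positivity : 0 ≤ (√(p i))⁻¹),
        div_le_iff₀ hsn]
      have h3 : 4 * B ≤ τ * √(n : ℝ) := by rwa [div_le_iff₀' hτ] at hn
      have h4 : B * δ * B = τ / 2 := by
        rw [hδ]
        field_simp
      calc |(t i : ℝ)| * (√(p i))⁻¹ ≤ (B * δ * √(n : ℝ) + 2) * B := by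
            gcongr
            exacts [ht2.trans hM2, hBi i]
        _ = B * δ * B * √(n : ℝ) + 2 * B := by ring
        _ ≤ _ := by rw [h4]; linarith
    have h := sum_multinomialMass_mul_exp_centered_le hp hsum (fun i => hexp _ (hθ i)) n
    refine le_trans (le_of_eq ?_) (h.trans (Real.exp_le_exp.2 ?_))
    · refine Finset.sum_congr rfl fun r _ => ?_
      congr 2
      refine Finset.sum_congr rfl fun i _ => ?_
      simp only [hy, centeredCounts]
      ring
    · refine mul_le_mul_of_nonneg_left ?_ (by linarith)
      rw [Finset.mul_sum]
      refine Finset.sum_le_sum fun i _ => ?_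
      by_cases hi : p i = 0
      · simp only [hi, zero_mul, mul_zero]
        positivity
      · have hpi : 0 < p i := (hp i).lt_of_ne' hi
        rw [div_pow, mul_pow, inv_pow, Real.sq_sqrt hpi.le, Real.sq_sqrt hn0'.le]
        refine le_of_eq ?_
        field_simp
  calc _ ≤ ∑ r ∈ (Finset.piAntidiag Finset.univ n).filter
          (fun r => ∀ i, |(r i : ℝ) / n - p i| ≤ δ),
          multinomialMass p r * (Real.exp (1 / (2 * κ)) ^ Fintype.card ι * ∑ t ∈ T,
            ∏ i, Real.exp (t i * y r i - (t i : ℝ) ^ 2 / (2 * κ))) :=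
        Finset.sum_le_sum fun r hr => mul_le_mul_of_nonneg_left
          (hpt r (Finset.mem_filter.1 hr).2) (multinomialMass_nonneg hp r)
    _ ≤ ∑ r ∈ Finset.piAntidiag Finset.univ n,
          multinomialMass p r * (Real.exp (1 / (2 * κ)) ^ Fintype.card ι * ∑ t ∈ T,
            ∏ i, Real.exp (t i * y r i - (t i : ℝ) ^ 2 / (2 * κ))) :=
        Finset.sum_le_sum_of_subset_of_nonneg (Finset.filter_subset _ _) fun r _ _ =>
          mul_nonneg (multinomialMass_nonneg hp r) (by positivity)
    _ = Real.exp (1 / (2 * κ)) ^ Fintype.card ι * ∑ t ∈ T,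
          Real.exp (-(∑ i, (t i : ℝ) ^ 2 / (2 * κ))) *
            ∑ r ∈ Finset.piAntidiag Finset.univ n,
              multinomialMass p r * Real.exp (∑ i, t i * y r i) := by
        simp only [Finset.mul_sum]
        rw [Finset.sum_comm]
        refine Finset.sum_congr rfl fun t _ => Finset.sum_congr rfl fun r _ => ?_
        rw [← Real.exp_sum, Finset.sum_sub_distrib, sub_eq_add_neg, Real.exp_add]
        ring
    _ ≤ Real.exp (1 / (2 * κ)) ^ Fintype.card ι * ∑ t ∈ T,
          Real.exp (-(∑ i, (t i : ℝ) ^ 2 / (2 * κ))) *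
            Real.exp ((1 + ε) / 2 * ∑ i, (t i : ℝ) ^ 2) := by
        gcongr with t ht
        exact hmgf t ht
    _ = Real.exp (1 / (2 * κ)) ^ Fintype.card ι * ∑ t ∈ T,
          ∏ i, Real.exp (-(c * (t i : ℝ) ^ 2)) := by
        congr 1
        refine Finset.sum_congr rfl fun t _ => ?_
        rw [← Real.exp_add, ← Real.exp_sum, ← Finset.sum_neg_distrib, Finset.mul_sum,
          ← Finset.sum_add_distrib]
        congr 1
        refine Finset.sum_congr rfl fun i _ => ?_
        rw [hcdef, hεdef]
        field_simp
        ring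
    _ ≤ _ := by
        rw [hT, ← Finset.prod_univ_sum (fun _ : ι => Finset.Icc (-(M : ℤ)) M)
          fun _ t => Real.exp (-(c * (t : ℝ) ^ 2)), Finset.prod_const, Finset.card_univ]
        have hSn : 0 ≤ ∑ t ∈ Finset.Icc (-(M : ℤ)) M, Real.exp (-(c * (t : ℝ) ^ 2)) :=
          Finset.sum_nonneg fun _ _ => Real.exp_nonneg _
        gcongr
        exact hS M

end NearBound

/-! ### Uniform bounds on expectations and tails -/

section KeyBound

lemma centeredCounts_eq_smul {ι : Type*} (p : ι → ℝ) {n : ℕ} (hn : 0 < n) (r : ι → ℕ) :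
    centeredCounts p n r = √(n : ℝ) • ((fun i => (r i : ℝ) / n) - p) := by
  have hn' : (0 : ℝ) < n := by exact_mod_cast hn
  ext i
  rw [centeredCounts, div_eq_iff (Real.sqrt_pos.2 hn').ne', Pi.smul_apply, smul_eq_mul,
    mul_right_comm, Real.mul_self_sqrt hn'.le, Pi.sub_apply]
  field_simp

lemma quadForm_centeredCounts {ι : Type*} [Fintype ι] (A : Matrix ι ι ℝ) (p : ι → ℝ) {n : ℕ}
    (hn : 0 < n) (r : ι → ℕ) :
    quadForm A (centeredCounts p n r) = n * quadForm A ((fun i => (r i : ℝ) / n) - p) := by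
  rw [centeredCounts_eq_smul p hn, quadForm_smul, Real.sq_sqrt (Nat.cast_nonneg n)]

lemma pow_mul_exp_neg_le {c : ℝ} (hc : 0 < c) (d n : ℕ) :
    ((n : ℝ) + 1) ^ d * Real.exp (-(n * c)) ≤ d.factorial * Real.exp c / c ^ d := by
  have h := Real.pow_div_factorial_le_exp (c * (n + 1)) (by positivity) d
  rw [div_le_iff₀ (by positivity), mul_pow] at h
  rw [le_div_iff₀ (by positivity)]
  calc _ = c ^ d * ((n : ℝ) + 1) ^ d * Real.exp (-(n * c)) := by ring
    _ ≤ Real.exp (c * (n + 1)) * d.factorial * Real.exp (-(n * c)) := by gcongr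
    _ = d.factorial * (Real.exp (c * (n + 1)) * Real.exp (-(n * c))) := by ring
    _ = _ := by
        rw [← Real.exp_add]
        congr 2
        ring

variable {s : ℕ} {π : Fin s → ℝ}

lemma div_mem_stdSimplex {ι : Type*} [Fintype ι] [DecidableEq ι] {n : ℕ} (hn : 0 < n) {r : ι → ℕ}
    (hr : r ∈ Finset.piAntidiag Finset.univ n) :
    (fun i => (r i : ℝ) / n) ∈ stdSimplex ℝ ι := by
  refine ⟨fun i => by positivity, ?_⟩
  rw [← Finset.sum_div, natCast_sum_eq_of_mem_piAntidiag hr, div_self (by positivity)]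

/-- Counts with `r / n` within `δ` of `p` are handled by `hA'` and the moment bound near the mean.
Each remaining count in `Ω_n` contributes at most `exp (-n c)`, by the entropy gap, and there are
only polynomially many of them. -/
theorem exists_bound_lintegral_restrictedExp (hπ : π ∈ stdSimplex ℝ (Fin s))
    {A : Matrix (Fin s × Fin s) (Fin s × Fin s) ℝ} {κ : ℝ} (hκ : 0 < κ) (hκ1 : κ < 1)
    (hA : ∀ α ∈ balancedSimplex π, quadForm A (α - prodDist π) ≤ κ * klSum α (prodDist π))
    (hA' : ∀ x : Fin s × Fin s → ℝ, (∀ i, prodDist π i = 0 → x i = 0) → ∑ i, x i = 0 →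
      quadForm A x ≤ κ / 2 * ∑ i, x i ^ 2 / prodDist π i)
    {a : ℕ → ℝ} (ha : Tendsto (fun n : ℕ => a n / (n : ℝ)) atTop (𝓝 0)) :
    ∃ C : ℝ, 0 ≤ C ∧ ∀ᶠ n : ℕ in atTop,
      ∫⁻ N, restrictedExp π A a n N ∂(multinomialLaw n (prodDist π)) ≤ ENNReal.ofReal C := by
  set p := prodDist π with hp
  have hp0 := prodDist_nonneg hπ
  have hp1 := sum_prodDist hπ
  obtain ⟨δ, hδ, C₁, hC₁⟩ := exists_bound_sum_multinomialMass_near hp0 hp1 hκ hκ1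
  obtain ⟨ρ, hρ, c, hc, hgap⟩ := exists_gap_of_nearlyBalanced hπ hκ1 hA hδ
  set d := Fintype.card (Fin s × Fin s)
  refine ⟨max 0 (C₁ + d.factorial * Real.exp c / c ^ d), le_max_left _ _, ?_⟩
  filter_upwards [hC₁, eventually_gt_atTop 0, ha.eventually (gt_mem_nhds hρ)] with n hn hn0 han
  have hn' : (0 : ℝ) < n := by exact_mod_cast hn0
  rw [lintegral_multinomialLaw]
  have hterm : ∀ r ∈ Finset.piAntidiag Finset.univ n,
      ENNReal.ofReal (multinomialMass p r) * restrictedExp π A a n r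
        ≤ ENNReal.ofReal ((if ∀ i, |(r i : ℝ) / n - p i| ≤ δ then multinomialMass p r *
          Real.exp (κ / 2 * ∑ i, centeredCounts p n r i ^ 2 / p i) else 0)
          + Real.exp (-(n * c))) := by
    intro r hr
    by_cases hsupp : ∀ i, p i = 0 → r i = 0
    swap
    · push Not at hsupp
      obtain ⟨i, hi, hri⟩ := hsupp
      rw [multinomialMass_eq_zero hi hri]
      simp
    by_cases hb : r ∈ nearlyBalanced π n (a n)
    swap
    · rw [restrictedExp, Set.indicator_of_notMem hb, mul_zero]
      exact zero_le
    rw [restrictedExp, Set.indicator_of_mem hb,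
      ← ENNReal.ofReal_mul (multinomialMass_nonneg hp0 r)]
    refine ENNReal.ofReal_le_ofReal ?_
    split_ifs with hnr
    · refine le_add_of_le_of_nonneg (mul_le_mul_of_nonneg_left (Real.exp_le_exp.2 ?_)
        (multinomialMass_nonneg hp0 r)) (Real.exp_nonneg _)
      refine hA' _ (fun i hi => ?_) ?_
      · change ((r i : ℝ) - n * p i) / √(n : ℝ) = 0
        rw [hsupp i hi, show p i = 0 from hi]
        simp
      · simp only [centeredCounts]
        rw [← Finset.sum_div, Finset.sum_sub_distrib, natCast_sum_eq_of_mem_piAntidiag hr,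
          ← Finset.mul_sum, hp1]
        simp
    · rw [zero_add]
      have hg := hgap _ (div_mem_stdSimplex hn0 hr) (fun i hi => by simp [hsupp i hi])
        (fun j => by
          have h1 := hb.1 j
          rw [← Finset.sum_div]
          have : (∑ i, (r (i, j) : ℝ)) / n - π j = ((∑ i, (r (i, j) : ℝ)) - n * π j) / n := by
            field_simp
          rw [this, abs_div, abs_of_pos hn']
          exact (div_le_div_of_nonneg_right h1 hn'.le).trans han.le)
        (fun j => by
          have h1 := hb.2 j
          rw [← Finset.sum_div]
          have : (∑ i, (r (j, i) : ℝ)) / n - π j = ((∑ i, (r (j, i) : ℝ)) - n * π j) / n := by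
            field_simp
          rw [this, abs_div, abs_of_pos hn']
          exact (div_le_div_of_nonneg_right h1 hn'.le).trans han.le)
        (by
          push Not at hnr
          obtain ⟨i, hi⟩ := hnr
          exact hi.le.trans (norm_le_pi_norm ((fun i => (r i : ℝ) / n) - p) i))
      rw [quadForm_centeredCounts A _ hn0]
      refine (mul_le_mul_of_nonneg_right (multinomialMass_le_exp_neg_klSum hp0 hn0 hr hsupp)
        (Real.exp_nonneg _)).trans ?_
      rw [← Real.exp_add, Real.exp_le_exp]
      nlinarith
  refine (Finset.sum_le_sum hterm).trans ?_
  rw [← ENNReal.ofReal_sum_of_nonneg fun r _ => add_nonneg (by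
    split_ifs
    · exact mul_nonneg (multinomialMass_nonneg hp0 r) (Real.exp_nonneg _)
    · exact le_rfl) (Real.exp_nonneg _)]
  refine ENNReal.ofReal_le_ofReal (le_trans ?_ (le_max_right _ _))
  rw [Finset.sum_add_distrib, ← Finset.sum_filter, Finset.sum_const, nsmul_eq_mul]
  refine add_le_add hn (le_trans ?_ (pow_mul_exp_neg_le hc d n))
  refine mul_le_mul_of_nonneg_right ?_ (Real.exp_nonneg _)
  exact_mod_cast card_piAntidiag_le n

/-- A uniform bound, for large `n`, on the tails `E[Y_n ; Y_n > K]`. -/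
theorem exists_tail_bound_restrictedExp (hπ : π ∈ stdSimplex ℝ (Fin s))
    {A : Matrix (Fin s × Fin s) (Fin s × Fin s) ℝ} {κ : ℝ} (hκ : 0 < κ) (hκ1 : κ < 1)
    (hA : ∀ α ∈ balancedSimplex π, quadForm A (α - prodDist π) ≤ κ * klSum α (prodDist π))
    (hA' : ∀ x : Fin s × Fin s → ℝ, (∀ i, prodDist π i = 0 → x i = 0) → ∑ i, x i = 0 →
      quadForm A x ≤ κ / 2 * ∑ i, x i ^ 2 / prodDist π i)
    {a : ℕ → ℝ} (ha : Tendsto (fun n : ℕ => a n / (n : ℝ)) atTop (𝓝 0)) :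
    ∃ η : ℝ, 0 < η ∧ ∃ C : ℝ, ∀ᶠ n : ℕ in atTop, ∀ K : ℝ≥0, 0 < K →
      ∫⁻ N in {N | (K : ℝ≥0∞) < restrictedExp π A a n N}, restrictedExp π A a n N
        ∂(multinomialLaw n (prodDist π)) ≤ ENNReal.ofReal ((K : ℝ) ^ (-η) * C) := by
  -- The midpoint of `1` and `1 / κ`: both hypotheses hold for `b A` with constant `b κ < 1`, which
  -- bounds the `b`-th moments.
  set b := (1 + 1 / κ) / 2 with hb
  have hκ' : 1 < 1 / κ := by rwa [one_lt_div hκ]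
  have hb1 : 1 < b := by linarith
  have hbκ : b * κ < 1 := by
    rw [hb]
    field_simp
    linarith
  obtain ⟨C, hC0, hC⟩ := exists_bound_lintegral_restrictedExp hπ (A := b • A) (κ := b * κ)
    (by positivity) hbκ
    (fun α hα => by
      rw [quadForm_smul_matrix, mul_assoc]
      exact mul_le_mul_of_nonneg_left (hA α hα) (by linarith))
    (fun x hx hx' => by
      rw [quadForm_smul_matrix, mul_div_assoc, mul_assoc]
      exact mul_le_mul_of_nonneg_left (hA' x hx hx') (by linarith)) ha
  refine ⟨b - 1, by linarith, C, ?_⟩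
  filter_upwards [hC] with n hn K hK
  have hK' : (0 : ℝ) < K := hK
  rw [← lintegral_indicator (MeasurableSet.of_discrete),
    ENNReal.ofReal_mul (by positivity)]
  refine le_trans ?_ (mul_le_mul_right hn _)
  rw [← lintegral_const_mul _ (Measurable.of_discrete)]
  refine lintegral_mono fun N => ?_
  by_cases hN : (K : ℝ≥0∞) < restrictedExp π A a n N
  swap
  · rw [Set.indicator_of_notMem (by simpa using hN)]
    exact zero_le
  rw [Set.indicator_of_mem (by simpa using hN)]
  by_cases hbal : N ∈ nearlyBalanced π n (a n)
  swap
  · simp [restrictedExp, hbal] at hN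
  simp only [restrictedExp, Set.indicator_of_mem hbal] at hN ⊢
  rw [← ENNReal.ofReal_mul (by positivity), quadForm_smul_matrix]
  refine ENNReal.ofReal_le_ofReal ?_
  set q := quadForm A (centeredCounts (prodDist π) n N)
  have hKq : (K : ℝ) < Real.exp q := by
    rw [← ENNReal.ofReal_coe_nnreal, ENNReal.ofReal_lt_ofReal_iff (Real.exp_pos _)] at hN
    exact hN
  have h1 : (K : ℝ) ^ (b - 1) ≤ Real.exp (q * (b - 1)) := by
    rw [Real.exp_mul]
    exact Real.rpow_le_rpow hK'.le hKq.le (by linarith)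
  -- Markov's trick: where `exp q > K`, one has `exp q ≤ K ^ (-(b - 1)) exp (b q)`.
  rw [Real.rpow_neg hK'.le, inv_mul_eq_div, le_div_iff₀ (by positivity)]
  calc _ ≤ Real.exp q * Real.exp (q * (b - 1)) := by gcongr
    _ = _ := by
        rw [← Real.exp_add]
        congr 1
        ring

end KeyBound

/-! ### The central limit theorem for the multinomial law -/

section CentralLimit

/-- The second-order Taylor term gives the limit; the remainder is at most `n |c / √n|³ = |c|³ /
√n`. -/
lemma tendsto_nat_mul_exp_div_sqrt_sub (c : ℝ) :
    Tendsto (fun n : ℕ => (n : ℂ) * (Complex.exp ((c / √(n : ℝ) : ℝ) * Complex.I) - 1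
      - (c / √(n : ℝ) : ℝ) * Complex.I)) atTop (𝓝 (-(c ^ 2 / 2 : ℝ))) := by
  have hsq : Tendsto (fun n : ℕ => √(n : ℝ)) atTop atTop :=
    Real.tendsto_sqrt_atTop.comp tendsto_natCast_atTop_atTop
  have hz : Tendsto (fun n : ℕ => |c| / √(n : ℝ)) atTop (𝓝 0) := hsq.const_div_atTop _
  have hz3 : Tendsto (fun n : ℕ => |c| ^ 3 / √(n : ℝ)) atTop (𝓝 0) := hsq.const_div_atTop _
  rw [tendsto_iff_norm_sub_tendsto_zero]
  refine squeeze_zero' (Eventually.of_forall fun _ => norm_nonneg _) ?_ hz3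
  filter_upwards [hz.eventually (gt_mem_nhds zero_lt_one), eventually_gt_atTop 0] with n hn hn0
  have hn' : (0 : ℝ) < n := by exact_mod_cast hn0
  have hs : 0 < √(n : ℝ) := Real.sqrt_pos.2 hn'
  set x : ℝ := c / √(n : ℝ) with hx
  have hxn : n * x ^ 2 = c ^ 2 := by
    rw [hx, div_pow, Real.sq_sqrt hn'.le]
    field_simp
  have hxabs : |x| = |c| / √(n : ℝ) := by rw [hx, abs_div, abs_of_pos hs]
  have hnorm : ‖(x : ℂ) * Complex.I‖ = |x| := by simp
  have h := Complex.exp_bound (x := (x : ℂ) * Complex.I) (by rw [hnorm, hxabs]; exact hn.le)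
    (n := 3) (by norm_num)
  rw [hnorm] at h
  have e : (n : ℂ) * (Complex.exp (x * Complex.I) - 1 - x * Complex.I) - (-(c ^ 2 / 2 : ℝ))
      = n * (Complex.exp (x * Complex.I)
        - ∑ m ∈ Finset.range 3, (x * Complex.I) ^ m / m.factorial) := by
    rw [← hxn]
    simp only [Finset.sum_range_succ, Finset.sum_range_zero, mul_pow, Complex.I_sq, Nat.factorial]
    push_cast
    ring
  rw [e, norm_mul, Complex.norm_natCast]
  calc (n : ℝ) * _ ≤ n * (|x| ^ 3 * 1) := by
        refine mul_le_mul_of_nonneg_left (h.trans ?_) hn'.le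
        refine mul_le_mul_of_nonneg_left ?_ (by positivity)
        norm_num [Nat.factorial]
    _ = _ := by
        rw [mul_one, pow_succ |x|, sq_abs, ← mul_assoc, hxn, hxabs, pow_succ |c|, sq_abs]
        ring

variable {ι : Type*} [Fintype ι] [DecidableEq ι]

lemma isProbabilityMeasure_multinomialLaw {p : ι → ℝ} (hp : ∀ i, 0 ≤ p i) (hsum : ∑ i, p i = 1)
    (n : ℕ) : IsProbabilityMeasure (multinomialLaw n p) := by
  refine ⟨?_⟩
  rw [← lintegral_one, lintegral_multinomialLaw]
  simp only [mul_one]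
  rw [← ENNReal.ofReal_sum_of_nonneg fun r _ => multinomialMass_nonneg hp r,
    sum_multinomialMass, hsum, one_pow, ENNReal.ofReal_one]

lemma integral_multinomialLaw {p : ι → ℝ} (hp : ∀ i, 0 ≤ p i) (n : ℕ) (f : (ι → ℕ) → ℂ) :
    ∫ N, f N ∂(multinomialLaw n p)
      = ∑ r ∈ Finset.piAntidiag Finset.univ n, (multinomialMass p r : ℂ) * f r := by
  rw [multinomialLaw, integral_finsetSum_measure fun r _ =>
    (integrable_dirac (by simp)).smul_measure ENNReal.ofReal_ne_top]
  refine Finset.sum_congr rfl fun r _ => ?_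
  rw [integral_smul_measure, integral_dirac]
  change (ENNReal.ofReal (multinomialMass p r)).toReal • f r = _
  rw [ENNReal.toReal_ofReal (multinomialMass_nonneg hp r), Complex.real_smul]

/-- The covariance form is the variance of `x` as a random variable under `p`, hence nonnegative. -/
lemma dotProduct_covariance_mulVec {p : ι → ℝ} (hsum : ∑ i, p i = 1) (x : ι → ℝ) :
    x ⬝ᵥ ((Matrix.diagonal p - Matrix.vecMulVec p p) *ᵥ x)
      = ∑ i, p i * (x i - ∑ j, p j * x j) ^ 2 := by
  have e : ∀ i, p i * (x i - ∑ j, p j * x j) ^ 2 = p i * x i ^ 2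
      - 2 * (∑ j, p j * x j) * (p i * x i) + (∑ j, p j * x j) ^ 2 * p i := fun i => by ring
  simp only [e, Finset.sum_add_distrib, Finset.sum_sub_distrib, ← Finset.mul_sum, hsum,
    Matrix.sub_mulVec, Matrix.vecMulVec_mulVec, dotProduct_sub]
  simp only [dotProduct, Matrix.mulVec_diagonal, Pi.smul_apply, MulOpposite.smul_eq_mul_unop,
    MulOpposite.unop_op, ← mul_assoc, ← Finset.sum_mul]
  have e1 : ∑ i, x i * p i * x i = ∑ i, p i * x i ^ 2 :=
    Finset.sum_congr rfl fun i _ => by ring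
  have e2 : ∑ i, x i * p i = ∑ i, p i * x i := Finset.sum_congr rfl fun i _ => by ring
  rw [e1, e2]
  ring

lemma posSemidef_diagonal_sub_vecMulVec {p : ι → ℝ} (hp : ∀ i, 0 ≤ p i) (hsum : ∑ i, p i = 1) :
    (Matrix.diagonal p - Matrix.vecMulVec p p).PosSemidef := by
  refine Matrix.PosSemidef.of_dotProduct_mulVec_nonneg ?_ fun x => ?_
  · ext i j
    simp only [Matrix.conjTranspose_apply, Matrix.sub_apply, Matrix.vecMulVec_apply, star_trivial,
      Matrix.diagonal_apply, mul_comm (p j), eq_comm (a := j)]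
    split_ifs with h <;> simp [h]
  · rw [star_trivial, dotProduct_covariance_mulVec hsum]
    exact Finset.sum_nonneg fun i _ => mul_nonneg (hp i) (sq_nonneg _)

/-- The **multivariate central limit theorem** for the multinomial law. -/
theorem tendsto_lintegral_multinomialLaw {p : ι → ℝ} (hp : ∀ i, 0 ≤ p i) (hsum : ∑ i, p i = 1)
    (f : BoundedContinuousFunction (EuclideanSpace ℝ ι) ℝ≥0) :
    Tendsto (fun n => ∫⁻ N, f (WithLp.toLp 2 (centeredCounts p n N)) ∂(multinomialLaw n p)) atTop
      (𝓝 (∫⁻ z, f z ∂(multivariateGaussian (0 : EuclideanSpace ℝ ι)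
        (Matrix.diagonal p - Matrix.vecMulVec p p)))) := by
  have hprob := isProbabilityMeasure_multinomialLaw hp hsum
  set X : ℕ → (ι → ℕ) → EuclideanSpace ℝ ι := fun n N => WithLp.toLp 2 (centeredCounts p n N)
  have hX : ∀ n, Measurable (X n) := fun n => Measurable.of_discrete
  set μ : ℕ → ProbabilityMeasure (EuclideanSpace ℝ ι) := fun n =>
    ⟨(multinomialLaw n p).map (X n), Measure.isProbabilityMeasure_map (hX n).aemeasurable⟩
  set ν : ProbabilityMeasure (EuclideanSpace ℝ ι) :=
    ⟨multivariateGaussian 0 (Matrix.diagonal p - Matrix.vecMulVec p p), inferInstance⟩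
  have hlim : Tendsto μ atTop (𝓝 ν) := by
    rw [ProbabilityMeasure.tendsto_iff_tendsto_charFun]
    intro t
    -- Since the counts sum to `n`, centring `X` amounts to replacing `t` by `c = t - m`. Then `∑
    -- p_i c_i = 0`, so the linear term may be subtracted in the base of the `n`-th power.
    set m := ∑ j, p j * t j with hm
    set c : ι → ℝ := fun i => t i - m with hc
    have hpc : ∑ i, p i * c i = 0 := by
      simp only [hc, mul_sub, Finset.sum_sub_distrib, ← Finset.sum_mul, hsum, one_mul, hm, sub_self]
    have hν : charFun (ν : Measure (EuclideanSpace ℝ ι)) t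
        = Complex.exp (-(∑ i, p i * c i ^ 2 / 2 : ℝ)) := by
      change charFun (multivariateGaussian 0 _) t = _
      rw [charFun_multivariateGaussian (posSemidef_diagonal_sub_vecMulVec hp hsum),
        dotProduct_covariance_mulVec hsum, ← Finset.sum_div]
      simp [hc, hm]
    have hμ : ∀ᶠ n : ℕ in atTop, charFun (μ n : Measure (EuclideanSpace ℝ ι)) t
        = (1 + ∑ i, (p i : ℂ) * (Complex.exp ((c i / √(n : ℝ) : ℝ) * Complex.I) - 1
          - (c i / √(n : ℝ) : ℝ) * Complex.I)) ^ n := by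
      filter_upwards [eventually_gt_atTop 0] with n hn
      change charFun ((multinomialLaw n p).map (X n)) t = _
      have hbase : 1 + ∑ i, (p i : ℂ) * (Complex.exp ((c i / √(n : ℝ) : ℝ) * Complex.I) - 1
          - (c i / √(n : ℝ) : ℝ) * Complex.I)
          = ∑ i, (p i : ℂ) * Complex.exp ((c i / √(n : ℝ) : ℝ) * Complex.I) := by
        have e1 : ∑ i, (p i : ℂ) = 1 := by exact_mod_cast hsum
        have e2 : ∑ i, (p i : ℂ) * ((c i / √(n : ℝ) : ℝ) * Complex.I) = 0 := by
          have : ∑ i, (p i : ℂ) * (c i : ℂ) = 0 := by exact_mod_cast hpc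
          calc _ = (∑ i, (p i : ℂ) * (c i : ℂ)) * (Complex.I / (√(n : ℝ) : ℝ)) := by
                rw [Finset.sum_mul]
                refine Finset.sum_congr rfl fun i _ => ?_
                push_cast
                ring
            _ = 0 := by rw [this, zero_mul]
        simp only [mul_sub, Finset.sum_sub_distrib, mul_one, e1, e2]
        ring
      rw [hbase, Finset.sum_pow_eq_sum_piAntidiag, charFun_apply, integral_map (hX n).aemeasurable
        (by fun_prop), integral_multinomialLaw hp]
      refine Finset.sum_congr rfl fun r hr => ?_
      have hrn := natCast_sum_eq_of_mem_piAntidiag hr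
      have hinner : inner ℝ (X n r) t = ∑ i, (r i : ℝ) * (c i / √(n : ℝ)) := by
        rw [PiLp.inner_apply]
        have e1 : ∀ i, inner ℝ ((X n r) i) (t i)
            = (r i : ℝ) * t i / √(n : ℝ) - n / √(n : ℝ) * (p i * t i) := fun i => by
          simp only [X, centeredCounts, RCLike.inner_apply, conj_trivial]
          ring
        have e2 : ∀ i, (r i : ℝ) * (c i / √(n : ℝ))
            = (r i : ℝ) * t i / √(n : ℝ) - m / √(n : ℝ) * r i := fun i => by
          simp only [hc]
          ring
        simp only [e1, e2, Finset.sum_sub_distrib, ← Finset.mul_sum, hrn, ← hm]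
        ring
      rw [hinner, multinomialMass]
      push_cast
      rw [Finset.sum_mul, Complex.exp_sum, mul_assoc, ← Finset.prod_mul_distrib]
      congr 1
      refine Finset.prod_congr rfl fun i _ => ?_
      rw [mul_pow, ← Complex.exp_nat_mul, mul_assoc]
    rw [hν, tendsto_congr' hμ]
    refine Complex.tendsto_one_add_pow_exp_of_tendsto ?_
    have e : ∀ n : ℕ, (n : ℂ) * ∑ i, (p i : ℂ) * (Complex.exp ((c i / √(n : ℝ) : ℝ) * Complex.I) - 1
          - (c i / √(n : ℝ) : ℝ) * Complex.I)
        = ∑ i, (p i : ℂ) * ((n : ℂ) * (Complex.exp ((c i / √(n : ℝ) : ℝ) * Complex.I) - 1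
          - (c i / √(n : ℝ) : ℝ) * Complex.I)) := fun n => by
      rw [Finset.mul_sum]
      exact Finset.sum_congr rfl fun i _ => by ring
    simp only [e]
    have hl : (-(∑ i, p i * c i ^ 2 / 2 : ℝ) : ℂ)
        = ∑ i, (p i : ℂ) * (-(c i ^ 2 / 2 : ℝ)) := by
      push_cast
      rw [← Finset.sum_neg_distrib]
      exact Finset.sum_congr rfl fun i _ => by ring
    rw [hl]
    exact tendsto_finsetSum _ fun i _ => (tendsto_nat_mul_exp_div_sqrt_sub (c i)).const_mul _
  have h := ProbabilityMeasure.tendsto_iff_forall_lintegral_tendsto.1 hlim f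
  refine h.congr fun n => ?_
  exact lintegral_map (by fun_prop) (hX n)

end CentralLimit

/-! ### Finite Gaussian moments and the quadratic bound -/

section Gaussian

/-- The integrand times the Gaussian density stays above a positive constant on the whole line. -/
lemma lintegral_exp_sq_gaussianReal {c : ℝ} (hc : 1 / 2 ≤ c) :
    ∫⁻ x, ENNReal.ofReal (Real.exp (c * x ^ 2)) ∂(gaussianReal 0 1) = ∞ := by
  rw [gaussianReal_of_var_ne_zero _ one_ne_zero,
    lintegral_withDensity_eq_lintegral_mul _ (measurable_gaussianPDF 0 1) (by fun_prop)]
  have hpos : 0 < (√(2 * Real.pi))⁻¹ := by positivity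
  rw [eq_top_iff]
  calc (∞ : ℝ≥0∞) = ∫⁻ _ : ℝ, ENNReal.ofReal ((√(2 * Real.pi))⁻¹) := by
        rw [lintegral_const, Real.volume_univ, ENNReal.mul_top (by simpa using hpos)]
    _ ≤ _ := by
        refine lintegral_mono fun x => ?_
        rw [Pi.mul_apply, gaussianPDF, ← ENNReal.ofReal_mul (gaussianPDFReal_nonneg _ _ _)]
        refine ENNReal.ofReal_le_ofReal ?_
        rw [gaussianPDFReal, mul_assoc, ← Real.exp_add, NNReal.coe_one, mul_one, mul_one, sub_zero]
        refine le_mul_of_one_le_right hpos.le (Real.one_le_exp ?_)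
        nlinarith [sq_nonneg x]

variable {ι : Type*} [Fintype ι] [DecidableEq ι]

lemma lintegral_exp_sum_sq_pi_gaussianReal {ι : Type*} [Fintype ι] (c : ι → ℝ) :
    ∫⁻ x, ENNReal.ofReal (Real.exp (∑ i, c i * x i ^ 2))
        ∂(Measure.pi fun _ : ι => gaussianReal 0 1)
      = ∏ i, ∫⁻ x, ENNReal.ofReal (Real.exp (c i * x ^ 2)) ∂(gaussianReal 0 1) := by
  have hm : ∀ i, Measurable fun x : ℝ => ENNReal.ofReal (Real.exp (c i * x ^ 2)) := fun i => by
    fun_prop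
  have h := lintegral_prod_eq_prod_lintegral_of_indepFun Finset.univ _
    (iIndepFun_pi (μ := fun _ : ι => gaussianReal 0 1) fun i => (hm i).aemeasurable)
    (fun i => (hm i).comp (measurable_pi_apply i))
  rw [lintegral_congr fun x => by
    rw [Real.exp_sum, ENNReal.ofReal_prod_of_nonneg fun _ _ => Real.exp_nonneg _], h]
  refine Finset.prod_congr rfl fun i _ => ?_
  exact (measurePreserving_eval (fun _ : ι => gaussianReal 0 1) i).lintegral_comp (hm i)

/-- By independence the integral is a product of positive factors, so a single infinite factor makes
it infinite. -/
lemma lt_half_of_lintegral_exp_sum_sq_ne_top {c : ι → ℝ}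
    (h : ∫⁻ x, ENNReal.ofReal (Real.exp (∑ i, c i * x i ^ 2))
      ∂(Measure.pi fun _ : ι => gaussianReal 0 1) ≠ ∞) (i : ι) : c i < 1 / 2 := by
  by_contra! hi
  apply h
  rw [lintegral_exp_sum_sq_pi_gaussianReal, ← Finset.mul_prod_erase _ _ (Finset.mem_univ i),
    lintegral_exp_sq_gaussianReal hi]
  refine ENNReal.top_mul (Finset.prod_ne_zero_iff.2 fun j _ => ?_)
  rw [Ne, lintegral_eq_zero_iff (by fun_prop)]
  intro h0
  obtain ⟨x, hx⟩ := h0.exists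
  simp only [Pi.zero_apply, ENNReal.ofReal_eq_zero] at hx
  exact absurd (Real.exp_pos (c j * x ^ 2)) (not_lt.2 hx)

lemma quadForm_sum_smul_eigenvectorBasis {M : Matrix ι ι ℝ} (hM : M.IsHermitian) (x : ι → ℝ) :
    quadForm M (∑ i, x i • hM.eigenvectorBasis i).ofLp = ∑ i, hM.eigenvalues i * x i ^ 2 := by
  set b := hM.eigenvectorBasis
  have h1 : M *ᵥ (∑ i, x i • b i).ofLp = (∑ i, (hM.eigenvalues i * x i) • b i).ofLp := by
    simp only [WithLp.ofLp_sum, WithLp.ofLp_smul, Matrix.mulVec_sum, Matrix.mulVec_smul]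
    refine Finset.sum_congr rfl fun i _ => ?_
    rw [hM.mulVec_eigenvectorBasis, smul_smul, mul_comm]
  rw [quadForm, h1]
  have h2 : (∑ i, x i • b i).ofLp ⬝ᵥ (∑ i, (hM.eigenvalues i * x i) • b i).ofLp
      = inner ℝ (∑ i, x i • b i) (∑ i, (hM.eigenvalues i * x i) • b i) := by
    rw [EuclideanSpace.inner_eq_star_dotProduct, star_trivial, dotProduct_comm]
  rw [h2, b.orthonormal.inner_sum]
  exact Finset.sum_congr rfl fun i _ => by rw [conj_trivial]; ring

/-- `A` need not be symmetric; symmetrizing keeps the form and makes the spectral theorem available.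
-/
lemma quadForm_mulVec {ι : Type*} [Fintype ι] (A R : Matrix ι ι ℝ) (w : ι → ℝ) :
    quadForm A (R *ᵥ w) = quadForm ((1 / 2 : ℝ) • (Rᵀ * (A + Aᵀ) * R)) w := by
  rw [quadForm_smul_matrix]
  have h : quadForm (Rᵀ * (A + Aᵀ) * R) w = (R *ᵥ w) ⬝ᵥ ((A + Aᵀ) *ᵥ (R *ᵥ w)) := by
    rw [quadForm, Matrix.mul_assoc, ← Matrix.mulVec_mulVec, ← Matrix.mulVec_mulVec,
      Matrix.dotProduct_mulVec, Matrix.vecMul_transpose]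
  have h2 : (R *ᵥ w) ⬝ᵥ (Aᵀ *ᵥ (R *ᵥ w)) = quadForm A (R *ᵥ w) := by
    rw [Matrix.dotProduct_mulVec, Matrix.vecMul_transpose, dotProduct_comm, quadForm]
  rw [h, Matrix.add_mulVec, dotProduct_add, h2]
  simp only [quadForm]
  ring

open scoped MatrixOrder in
/-- If the Gaussian exponential moment of a quadratic form is finite, the form is bounded by a
fraction of half the inverse covariance. -/
theorem exists_quadForm_le_of_gaussianExpMoment_ne_top {p : ι → ℝ} (hp : ∀ i, 0 ≤ p i)
    (hsum : ∑ i, p i = 1) {A : Matrix ι ι ℝ} (hA : gaussianExpMoment p A ≠ ∞) :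
    ∃ κ : ℝ, 0 < κ ∧ κ < 1 ∧ ∀ x : ι → ℝ, (∀ i, p i = 0 → x i = 0) → ∑ i, x i = 0 →
      quadForm A x ≤ κ / 2 * ∑ i, x i ^ 2 / p i := by
  set S := Matrix.diagonal p - Matrix.vecMulVec p p with hS
  have hSpos : S.PosSemidef := posSemidef_diagonal_sub_vecMulVec hp hsum
  set R := CFC.sqrt S with hR
  have hRR : R * R = S := CFC.sqrt_mul_sqrt_self S hSpos.nonneg
  have hRT : Rᵀ = R := by
    have h : R.PosSemidef := Matrix.nonneg_iff_posSemidef.1 (CFC.sqrt_nonneg S)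
    simpa using h.isHermitian.eq
  set M := (1 / 2 : ℝ) • (Rᵀ * (A + Aᵀ) * R) with hMdef
  have hM : M.IsHermitian := by
    rw [Matrix.IsHermitian, Matrix.conjTranspose_eq_transpose_of_trivial, hMdef]
    simp only [Matrix.transpose_smul, Matrix.transpose_mul, Matrix.transpose_add,
      Matrix.transpose_transpose, add_comm Aᵀ A, Matrix.mul_assoc]
  set b := hM.eigenvectorBasis with hb
  -- `Z` is `R` applied to a standard Gaussian vector, whose coordinates in the eigenbasis of `M`
  -- are again independent standard Gaussians.
  have hmom : gaussianExpMoment p A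
      = ∫⁻ x, ENNReal.ofReal (Real.exp (∑ i, hM.eigenvalues i * x i ^ 2))
        ∂(Measure.pi fun _ : ι => gaussianReal 0 1) := by
    have hc := continuous_quadForm A
    rw [gaussianExpMoment, multivariateGaussian, lintegral_map (by fun_prop) (by fun_prop),
      stdGaussian_eq_map_pi_orthonormalBasis b]
    rw [lintegral_map (by fun_prop) (by fun_prop)]
    refine lintegral_congr fun x => ?_
    rw [zero_add, Matrix.ofLp_toEuclideanCLM, quadForm_mulVec, quadForm_sum_smul_eigenvectorBasis]
  rw [hmom] at hA
  have hlt := lt_half_of_lintegral_exp_sum_sq_ne_top hA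
  have hev : ∀ᶠ κ : ℝ in 𝓝[<] 1, 0 < κ ∧ κ < 1 ∧ ∀ i, 2 * hM.eigenvalues i < κ := by
    refine (Eventually.filter_mono nhdsWithin_le_nhds (lt_mem_nhds zero_lt_one)).and
      (Eventually.and self_mem_nhdsWithin (eventually_all.2 fun i => ?_))
    exact Eventually.filter_mono nhdsWithin_le_nhds (lt_mem_nhds (by linarith [hlt i]))
  obtain ⟨κ, hκ, hκ1, hκe⟩ := hev.exists
  refine ⟨κ, hκ, hκ1, fun x hx hx0 => ?_⟩
  -- `S` is singular, but `g = x / p` solves `S g = x` because `x` has sum zero. Then `w = R g`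
  -- satisfies `R w = x` and `|w|² = g ⬝ᵥ x = ∑ x_i² / p_i`.
  set g : ι → ℝ := fun i => x i / p i with hg
  have hpg : ∀ i, p i * g i = x i := fun i => by
    by_cases hi : p i = 0
    · rw [hi, zero_mul, hx i hi]
    · exact mul_div_cancel₀ _ hi
  have hSg : S *ᵥ g = x := by
    have h0 : p ⬝ᵥ g = 0 := by
      rw [dotProduct, ← hx0]
      exact Finset.sum_congr rfl fun i _ => hpg i
    ext i
    rw [hS, Matrix.sub_mulVec, Matrix.vecMulVec_mulVec, h0]
    simp [Matrix.mulVec_diagonal, hpg]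
  set w : EuclideanSpace ℝ ι := WithLp.toLp 2 (R *ᵥ g) with hw
  have hRw : R *ᵥ w.ofLp = x := by rw [hw, Matrix.mulVec_mulVec, hRR, hSg]
  have hwsum : w = ∑ i, b.repr w i • b i := (b.sum_repr w).symm
  have hwnorm : ∑ i, (b.repr w i) ^ 2 = ∑ i, x i ^ 2 / p i := by
    have h1 : ∑ i, (b.repr w i) ^ 2 = w.ofLp ⬝ᵥ w.ofLp := by
      rw [← EuclideanSpace.real_norm_sq_eq, LinearIsometryEquiv.norm_map,
        EuclideanSpace.real_norm_sq_eq, dotProduct]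
      exact Finset.sum_congr rfl fun i _ => by ring
    have h2 : w.ofLp ⬝ᵥ w.ofLp = g ⬝ᵥ x := by
      rw [show w.ofLp ⬝ᵥ w.ofLp = (R *ᵥ g) ⬝ᵥ w.ofLp from rfl, ← Matrix.vecMul_transpose R, hRT,
        ← Matrix.dotProduct_mulVec, hRw]
    rw [h1, h2, dotProduct]
    exact Finset.sum_congr rfl fun i _ => by rw [hg]; ring
  rw [← hRw, quadForm_mulVec, hRw]
  change quadForm M w.ofLp ≤ _
  rw [hwsum, quadForm_sum_smul_eigenvectorBasis hM, ← hwnorm, Finset.mul_sum]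
  refine Finset.sum_le_sum fun i _ => mul_le_mul_of_nonneg_right ?_ (sq_nonneg _)
  linarith [hκe i]

end Gaussian

/-! ### Convergence and uniform integrability -/

section Limits

variable {s : ℕ} {π : Fin s → ℝ}

lemma tendsto_lintegral_ofReal_multinomialLaw {ι : Type*} [Fintype ι] [DecidableEq ι] {p : ι → ℝ}
    (hp : ∀ i, 0 ≤ p i) (hsum : ∑ i, p i = 1) {g : EuclideanSpace ℝ ι → ℝ} (hg : Continuous g)
    {K : ℝ} (hK : ∀ z, g z ≤ K) :
    Tendsto (fun n => ∫⁻ N, ENNReal.ofReal (g (WithLp.toLp 2 (centeredCounts p n N)))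
        ∂(multinomialLaw n p)) atTop
      (𝓝 (∫⁻ z, ENNReal.ofReal (g z) ∂(multivariateGaussian (0 : EuclideanSpace ℝ ι)
        (Matrix.diagonal p - Matrix.vecMulVec p p)))) :=
  tendsto_lintegral_multinomialLaw hp hsum
    (BoundedContinuousFunction.mkOfBound ⟨fun z => (g z).toNNReal, by fun_prop⟩ K.toNNReal
      fun x y => by
        rw [NNReal.dist_eq, abs_le]
        have h1 : ((g x).toNNReal : ℝ) ≤ K.toNNReal := by
          exact_mod_cast Real.toNNReal_le_toNNReal (hK x)
        have h2 : ((g y).toNNReal : ℝ) ≤ K.toNNReal := by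
          exact_mod_cast Real.toNNReal_le_toNNReal (hK y)
        have h3 : (0 : ℝ) ≤ (g x).toNNReal := NNReal.coe_nonneg _
        have h4 : (0 : ℝ) ≤ (g y).toNNReal := NNReal.coe_nonneg _
        constructor <;> simp only [ContinuousMap.coe_mk] <;> linarith)

lemma mem_nearlyBalanced_of_norm_le (hπ : π ∈ stdSimplex ℝ (Fin s)) {n : ℕ} (hn : 0 < n)
    {N : Fin s × Fin s → ℕ} {ρ t : ℝ}
    (hN : ‖(WithLp.toLp 2 (centeredCounts (prodDist π) n N) : EuclideanSpace ℝ (Fin s × Fin s))‖ ≤ ρ)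
    (ht : s * ρ ≤ t / √(n : ℝ)) : N ∈ nearlyBalanced π n t := by
  have hs : 0 < √(n : ℝ) := Real.sqrt_pos.2 (by exact_mod_cast hn)
  rw [le_div_iff₀ hs] at ht
  have hX : ∀ i, |(N i : ℝ) - n * prodDist π i| ≤ ρ * √(n : ℝ) := fun i => by
    have h1 := (PiLp.norm_apply_le (WithLp.toLp 2 (centeredCounts (prodDist π) n N)) i).trans hN
    simp only [centeredCounts, norm_div, Real.norm_eq_abs, abs_of_pos hs] at h1
    rwa [div_le_iff₀ hs] at h1
  have hb := prodDist_mem_balancedSimplex hπ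
  have key : ∀ (f : Fin s → Fin s × Fin s) (c : ℝ), ∑ i, prodDist π (f i) = c →
      |(∑ i, (N (f i) : ℝ)) - n * c| ≤ t := fun f c hc => by
    rw [← hc, Finset.mul_sum, ← Finset.sum_sub_distrib]
    refine (Finset.abs_sum_le_sum_abs _ _).trans
      ((Finset.sum_le_card_nsmul Finset.univ _ _ fun i _ => hX (f i)).trans ?_)
    simpa [mul_assoc] using ht
  exact ⟨fun j => key (fun i => (i, j)) _ (hb.2.1 j), fun i => key (fun j => (i, j)) _ (hb.2.2 i)⟩

/-- Lower semicontinuity: the expectations are asymptotically at least the Gaussian moment. -/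
theorem eventually_lt_lintegral_restrictedExp (hπ : π ∈ stdSimplex ℝ (Fin s))
    (A : Matrix (Fin s × Fin s) (Fin s × Fin s) ℝ) {a : ℕ → ℝ}
    (ha : Tendsto (fun n : ℕ => a n / √(n : ℝ)) atTop atTop) {c : ℝ≥0∞}
    (hc : c < gaussianExpMoment (prodDist π) A) :
    ∀ᶠ n in atTop, c < ∫⁻ N, restrictedExp π A a n N ∂(multinomialLaw n (prodDist π)) := by
  set p := prodDist π with hp
  have hqc : Continuous fun z : EuclideanSpace ℝ (Fin s × Fin s) => quadForm A z.ofLp :=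
    (continuous_quadForm A).comp (PiLp.continuous_ofLp _ _)
  -- Bounded continuous functions increasing to `exp q`, with support in the ball of radius `R + 1`.
  -- That ball lies in `Ω_n` for large `n` because `a n / √n → ∞`.
  set g : ℕ → EuclideanSpace ℝ (Fin s × Fin s) → ℝ := fun R z =>
    min (Real.exp (quadForm A z.ofLp)) R * max 0 (min 1 (R + 1 - ‖z‖)) with hg
  have hgc : ∀ R, Continuous (g R) := fun R => by fun_prop
  have hclamp : ∀ (R : ℕ) (z : EuclideanSpace ℝ (Fin s × Fin s)),
      0 ≤ max 0 (min 1 ((R : ℝ) + 1 - ‖z‖)) ∧ max 0 (min 1 ((R : ℝ) + 1 - ‖z‖)) ≤ 1 :=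
    fun R z => ⟨le_max_left _ _, max_le zero_le_one (min_le_left _ _)⟩
  have hmin0 : ∀ (R : ℕ) (z : EuclideanSpace ℝ (Fin s × Fin s)),
      0 ≤ min (Real.exp (quadForm A z.ofLp)) (R : ℝ) :=
    fun R z => le_min (Real.exp_nonneg _) (Nat.cast_nonneg _)
  have hgle : ∀ R z, g R z ≤ min (Real.exp (quadForm A z.ofLp)) R := fun R z =>
    mul_le_of_le_one_right (hmin0 R z) (hclamp R z).2
  have hmono : ∀ z, Monotone fun R => ENNReal.ofReal (g R z) := fun z R R' h => by
    have h' : (R : ℝ) ≤ R' := by exact_mod_cast h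
    refine ENNReal.ofReal_le_ofReal (mul_le_mul ?_ ?_ (hclamp R z).1 (hmin0 R' z))
    · exact min_le_min le_rfl h'
    · exact max_le_max le_rfl (min_le_min le_rfl (by linarith))
  have hlim : ∀ z, Tendsto (fun R => ENNReal.ofReal (g R z)) atTop
      (𝓝 (ENNReal.ofReal (Real.exp (quadForm A z.ofLp)))) := fun z => by
    refine tendsto_const_nhds.congr' ?_
    filter_upwards [tendsto_natCast_atTop_atTop.eventually_ge_atTop (Real.exp (quadForm A z.ofLp)),
      tendsto_natCast_atTop_atTop.eventually_ge_atTop ‖z‖] with R h1 h2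
    rw [hg]
    simp only
    rw [min_eq_left h1, min_eq_left (by linarith), max_eq_right zero_le_one, mul_one]
  have hint := lintegral_tendsto_of_tendsto_of_monotone
    (μ := multivariateGaussian (0 : EuclideanSpace ℝ (Fin s × Fin s))
      (Matrix.diagonal p - Matrix.vecMulVec p p))
    (fun R => (show Measurable fun z => ENNReal.ofReal (g R z) from
      ((hgc R).measurable).ennreal_ofReal).aemeasurable)
    (ae_of_all _ hmono) (ae_of_all _ hlim)
  obtain ⟨R, hR⟩ := (hint.eventually (lt_mem_nhds hc)).exists
  have hconv := tendsto_lintegral_ofReal_multinomialLaw (prodDist_nonneg hπ) (sum_prodDist hπ)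
    (hgc R) (K := R) fun z => (hgle R z).trans (min_le_right _ _)
  filter_upwards [hconv.eventually (lt_mem_nhds hR), eventually_gt_atTop 0,
    ha.eventually_ge_atTop (s * ((R : ℝ) + 1))] with n hn hn0 han
  refine hn.trans_le (lintegral_mono fun N => ?_)
  by_cases hN : ‖(WithLp.toLp 2 (centeredCounts (prodDist π) n N) :
      EuclideanSpace ℝ (Fin s × Fin s))‖ ≤ R + 1
  · rw [restrictedExp, Set.indicator_of_mem (mem_nearlyBalanced_of_norm_le hπ hn0 hN han)]
    exact ENNReal.ofReal_le_ofReal ((hgle R _).trans (min_le_left _ _))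
  · rw [hg]
    simp only
    rw [max_eq_left (min_le_of_right_le (by linarith)), mul_zero, ENNReal.ofReal_zero]
    exact zero_le

lemma tendsto_ofReal_rpow_neg_mul {η : ℝ} (hη : 0 < η) (C : ℝ) :
    Tendsto (fun K : ℝ≥0 => ENNReal.ofReal ((K : ℝ) ^ (-η) * C)) atTop (𝓝 0) := by
  have h := (((tendsto_rpow_neg_atTop hη).comp
    (NNReal.tendsto_coe_atTop.2 tendsto_id)).mul_const C)
  rw [zero_mul] at h
  simpa using ENNReal.tendsto_ofReal h

lemma lintegral_le_add_tail {E : Type*} [MeasurableSpace E] [DiscreteMeasurableSpace E]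
    (μ : Measure E) (Y f : E → ℝ≥0∞) {K : ℝ≥0∞} (h : ∀ x, Y x ≤ K → Y x ≤ f x) :
    ∫⁻ x, Y x ∂μ ≤ ∫⁻ x, f x ∂μ + ∫⁻ x in {x | K < Y x}, Y x ∂μ := by
  rw [← lintegral_indicator MeasurableSet.of_discrete,
    ← lintegral_add_left Measurable.of_discrete]
  refine lintegral_mono fun x => ?_
  by_cases hx : K < Y x
  · rw [Set.indicator_of_mem (by simpa using hx)]
    exact le_add_self
  · exact (h x (not_lt.1 hx)).trans le_self_add

/-- Truncating at a large `K` costs at most the uniform tail bound. On the truncated part the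
indicator of `Ω_n` can be dropped, and the central limit theorem applies. -/
theorem eventually_lintegral_restrictedExp_lt (hπ : π ∈ stdSimplex ℝ (Fin s))
    {A : Matrix (Fin s × Fin s) (Fin s × Fin s) ℝ} {κ : ℝ} (hκ : 0 < κ) (hκ1 : κ < 1)
    (hA : ∀ α ∈ balancedSimplex π, quadForm A (α - prodDist π) ≤ κ * klSum α (prodDist π))
    (hA' : ∀ x : Fin s × Fin s → ℝ, (∀ i, prodDist π i = 0 → x i = 0) → ∑ i, x i = 0 →
      quadForm A x ≤ κ / 2 * ∑ i, x i ^ 2 / prodDist π i)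
    {a : ℕ → ℝ} (ha : Tendsto (fun n : ℕ => a n / (n : ℝ)) atTop (𝓝 0)) {c : ℝ≥0∞}
    (hc : gaussianExpMoment (prodDist π) A < c) :
    ∀ᶠ n in atTop, ∫⁻ N, restrictedExp π A a n N ∂(multinomialLaw n (prodDist π)) < c := by
  obtain ⟨η, hη, C, htail⟩ := exists_tail_bound_restrictedExp hπ hκ hκ1 hA hA' ha
  have h0 := (tendsto_ofReal_rpow_neg_mul hη C).const_add (gaussianExpMoment (prodDist π) A)
  rw [add_zero] at h0
  obtain ⟨K, hK, hK0⟩ := ((h0.eventually (gt_mem_nhds hc)).and (eventually_gt_atTop 0)).exists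
  have hqc : Continuous fun z : EuclideanSpace ℝ (Fin s × Fin s) => quadForm A z.ofLp :=
    (continuous_quadForm A).comp (PiLp.continuous_ofLp _ _)
  have hconv := (tendsto_lintegral_ofReal_multinomialLaw (prodDist_nonneg hπ) (sum_prodDist hπ)
    (g := fun z => min (Real.exp (quadForm A z.ofLp)) K) (by fun_prop) (K := K)
    fun z => min_le_right _ _).add_const (ENNReal.ofReal ((K : ℝ) ^ (-η) * C))
  have hlt : ∫⁻ z, ENNReal.ofReal (min (Real.exp (quadForm A z.ofLp)) K)
      ∂(multivariateGaussian (0 : EuclideanSpace ℝ (Fin s × Fin s))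
        (Matrix.diagonal (prodDist π) - Matrix.vecMulVec (prodDist π) (prodDist π)))
      + ENNReal.ofReal ((K : ℝ) ^ (-η) * C) < c :=
    (add_le_add_left (lintegral_mono fun z =>
      ENNReal.ofReal_le_ofReal (min_le_left _ _)) _).trans_lt hK
  filter_upwards [htail, hconv.eventually (gt_mem_nhds hlt)] with n h1 h2
  refine ((lintegral_le_add_tail _ _ (fun N => ENNReal.ofReal (min (Real.exp (quadForm A
    (centeredCounts (prodDist π) n N))) K)) (K := K) fun N hN => ?_).trans
      (add_le_add_right (h1 K hK0) _)).trans_lt h2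
  by_cases hb : N ∈ nearlyBalanced π n (a n)
  · rw [restrictedExp, Set.indicator_of_mem hb] at hN ⊢
    refine ENNReal.ofReal_le_ofReal (le_min le_rfl ?_)
    rw [← ENNReal.ofReal_coe_nnreal] at hN
    exact (ENNReal.ofReal_le_ofReal_iff (NNReal.coe_nonneg K)).1 hN
  · rw [restrictedExp, Set.indicator_of_notMem hb]
    exact zero_le

/-- The tail bound covers all large `n`. For each of the finitely many others the law has finite
support, so the tail vanishes for large `K`. -/
theorem uniformlyIntegrableSeq_restrictedExp (hπ : π ∈ stdSimplex ℝ (Fin s))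
    {A : Matrix (Fin s × Fin s) (Fin s × Fin s) ℝ} {κ : ℝ} (hκ : 0 < κ) (hκ1 : κ < 1)
    (hA : ∀ α ∈ balancedSimplex π, quadForm A (α - prodDist π) ≤ κ * klSum α (prodDist π))
    (hA' : ∀ x : Fin s × Fin s → ℝ, (∀ i, prodDist π i = 0 → x i = 0) → ∑ i, x i = 0 →
      quadForm A x ≤ κ / 2 * ∑ i, x i ^ 2 / prodDist π i)
    {a : ℕ → ℝ} (ha : Tendsto (fun n : ℕ => a n / (n : ℝ)) atTop (𝓝 0)) :
    UniformlyIntegrableSeq (fun n => multinomialLaw n (prodDist π)) (restrictedExp π A a) := by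
  obtain ⟨η, hη, C, htail⟩ := exists_tail_bound_restrictedExp hπ hκ hκ1 hA hA' ha
  obtain ⟨n₀, hn₀⟩ := eventually_atTop.1 htail
  have hfin : ∀ n, ∀ᶠ K : ℝ≥0 in atTop,
      ∫⁻ N in {N | (K : ℝ≥0∞) < restrictedExp π A a n N}, restrictedExp π A a n N
        ∂(multinomialLaw n (prodDist π)) = 0 := fun n => by
    set B := ∑ r ∈ Finset.piAntidiag Finset.univ n, restrictedExp π A a n r with hB
    have hBtop : B ≠ ∞ := ENNReal.sum_ne_top.2 fun r _ => by
      by_cases hb : r ∈ nearlyBalanced π n (a n) <;> simp [restrictedExp, hb]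
    filter_upwards [eventually_ge_atTop B.toNNReal] with K hK
    rw [← lintegral_indicator MeasurableSet.of_discrete, lintegral_multinomialLaw]
    refine Finset.sum_eq_zero fun r hr => ?_
    rw [Set.indicator_of_notMem, mul_zero]
    have h1 : restrictedExp π A a n r ≤ B :=
      Finset.single_le_sum (f := restrictedExp π A a n) (fun _ _ => zero_le) hr
    have h2 : B ≤ K := by
      rw [← ENNReal.coe_toNNReal hBtop]
      exact_mod_cast hK
    simpa using h1.trans h2
  refine tendsto_of_tendsto_of_tendsto_of_le_of_le' tendsto_const_nhds
    (tendsto_ofReal_rpow_neg_mul hη C) (Eventually.of_forall fun _ => zero_le) ?_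
  filter_upwards [(eventually_all_finset (Finset.range n₀)).2 fun n _ => hfin n,
    eventually_gt_atTop 0] with K hK hK0
  refine iSup_le fun n => ?_
  by_cases hn : n < n₀
  · rw [hK n (Finset.mem_range.2 hn)]
    exact zero_le
  · exact hn₀ n (not_lt.1 hn) K hK0

end Limits

/-! ### Divergence above the threshold -/

section Supercritical

/-- Integer counts summing to `n` which approximate `n α` up to a bounded error. -/
lemma exists_counts_near {ι : Type*} [Fintype ι] [DecidableEq ι] {α : ι → ℝ}
    (hα : α ∈ stdSimplex ℝ ι) (n : ℕ) :
    ∃ r ∈ Finset.piAntidiag (Finset.univ : Finset ι) n, (∀ i, α i = 0 → r i = 0) ∧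
      ∀ i, |(r i : ℝ) - n * α i| ≤ Fintype.card ι := by
  -- An index in the support of `α` absorbs the whole rounding deficit, so no count appears outside
  -- the support.
  obtain ⟨i₀, hi₀⟩ : ∃ i, α i ≠ 0 := by
    by_contra! h
    have := hα.2
    simp [h] at this
  set f : ι → ℕ := fun i => ⌊n * α i⌋₊ with hf
  have hnα : ∀ i, 0 ≤ n * α i := fun i => mul_nonneg (Nat.cast_nonneg _) (hα.1 i)
  have hfle : ∀ i, (f i : ℝ) ≤ n * α i := fun i => Nat.floor_le (hnα i)
  have hflt : ∀ i, n * α i < f i + 1 := fun i => Nat.lt_floor_add_one _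
  have hsum : ∑ i, n * α i = n := by rw [← Finset.mul_sum, hα.2, mul_one]
  have hle : ∑ i, f i ≤ n := by
    have h : ∑ i, (f i : ℝ) ≤ n := (Finset.sum_le_sum fun i _ => hfle i).trans hsum.le
    exact_mod_cast h
  have hcard : (n : ℝ) - ∑ i, (f i : ℝ) ≤ Fintype.card ι := by
    have h : ∑ i, n * α i ≤ ∑ i, ((f i : ℝ) + 1) := Finset.sum_le_sum fun i _ => (hflt i).le
    rw [hsum, Finset.sum_add_distrib] at h
    simp only [Finset.sum_const, Finset.card_univ, nsmul_eq_mul, mul_one] at h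
    linarith
  have hcard1 : (1 : ℝ) ≤ Fintype.card ι := by
    exact_mod_cast Fintype.card_pos_iff.2 ⟨i₀⟩
  have hge : 0 ≤ (n : ℝ) - ∑ i, (f i : ℝ) := by
    have : ((∑ i, f i : ℕ) : ℝ) ≤ n := by exact_mod_cast hle
    push_cast at this
    linarith
  refine ⟨fun i => f i + if i = i₀ then n - ∑ j, f j else 0, ?_, fun i hi => ?_, fun i => ?_⟩
  · rw [Finset.mem_piAntidiag]
    refine ⟨?_, fun _ _ => Finset.mem_univ _⟩
    rw [Finset.sum_add_distrib, Finset.sum_ite_eq' Finset.univ i₀, if_pos (Finset.mem_univ _)]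
    omega
  · have hne : i ≠ i₀ := fun h => hi₀ (h ▸ hi)
    simp [hf, hi, hne]
  · by_cases h : i = i₀
    · simp only [h, if_true]
      push_cast [Nat.cast_sub hle]
      rw [abs_le]
      constructor <;> linarith [hfle i₀, hflt i₀]
    · simp only [h, if_false, add_zero]
      rw [abs_le]
      constructor <;> linarith [hfle i, hflt i]

variable {s : ℕ} {π : Fin s → ℝ}

/-- One count vector close to `n α` suffices. Of the gap `ε`, half is lost to rounding and a quarter
to the polynomial factor in the lower bound on its mass, which leaves growth `exp (n ε / 4)`. -/
lemma tendsto_lintegral_restrictedExp_top (hπ : π ∈ stdSimplex ℝ (Fin s))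
    {A : Matrix (Fin s × Fin s) (Fin s × Fin s) ℝ} {a : ℕ → ℝ}
    (ha : Tendsto (fun n : ℕ => a n / √(n : ℝ)) atTop atTop) {α : Fin s × Fin s → ℝ}
    (hα : α ∈ balancedSimplex π)
    (hlt : klSum α (prodDist π) < quadForm A (α - prodDist π)) :
    Tendsto (fun n : ℕ => ∫⁻ N, restrictedExp π A a n N ∂(multinomialLaw n (prodDist π)))
      atTop (𝓝 ∞) := by
  set p := prodDist π with hp
  set d := Fintype.card (Fin s × Fin s) with hd
  choose r hr hr0 hrn using exists_counts_near hα.1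
  have hsupp : ∀ n i, p i = 0 → r n i = 0 := fun n i hi =>
    hr0 n i (eq_zero_of_mem_balancedSimplex hα i hi)
  have hconv : Tendsto (fun (n : ℕ) i => (r n i : ℝ) / n) atTop (𝓝 α) := by
    refine tendsto_pi_nhds.2 fun i => ?_
    rw [tendsto_iff_norm_sub_tendsto_zero]
    refine squeeze_zero' (Eventually.of_forall fun _ => norm_nonneg _) ?_
      (tendsto_const_div_atTop_nhds_zero_nat (d : ℝ))
    filter_upwards [eventually_gt_atTop 0] with n hn
    have hn' : (0 : ℝ) < n := by exact_mod_cast hn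
    have e : (r n i : ℝ) / n - α i = (r n i - n * α i) / n := by field_simp
    rw [e, norm_div, Real.norm_eq_abs, Real.norm_eq_abs, abs_of_pos hn']
    exact div_le_div_of_nonneg_right (hrn n i) hn'.le
  set ε := quadForm A (α - p) - klSum α p with hε
  have hεpos : 0 < ε := by linarith
  have hgap : ∀ᶠ n : ℕ in atTop, ε / 2 < quadForm A ((fun i => (r n i : ℝ) / n) - p)
      - klSum (fun i => (r n i : ℝ) / n) p := by
    have hc : Continuous fun β : Fin s × Fin s → ℝ => quadForm A (β - p) - klSum β p :=
      ((continuous_quadForm A).comp (continuous_id.sub continuous_const)).sub (continuous_klSum p)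
    exact ((hc.tendsto α).comp hconv).eventually (lt_mem_nhds (by linarith))
  set C := (d.factorial : ℝ) * Real.exp (ε / 4) / (ε / 4) ^ d with hC
  have hCpos : 0 < C := by positivity
  have hgrow : Tendsto (fun n : ℕ => ENNReal.ofReal
      ((Real.exp 1 ^ d * C)⁻¹ * Real.exp (n * (ε / 4)))) atTop (𝓝 ∞) := by
    refine ENNReal.tendsto_ofReal_atTop.comp (Tendsto.const_mul_atTop (by positivity)
      (Real.tendsto_exp_atTop.comp ?_))
    exact tendsto_natCast_atTop_atTop.atTop_mul_const (by positivity)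
  refine tendsto_nhds_top_mono hgrow ?_
  filter_upwards [hgap, eventually_gt_atTop 0, ha.eventually_ge_atTop (s * (d : ℝ))]
    with n hn hn0 han
  have hn' : (0 : ℝ) < n := by exact_mod_cast hn0
  have hs1 : 1 ≤ √(n : ℝ) := Real.one_le_sqrt.2 (by exact_mod_cast hn0)
  have hmem : r n ∈ nearlyBalanced π n (a n) := by
    have hsd : s * (d : ℝ) ≤ a n := by
      rw [le_div_iff₀ (by positivity)] at han
      exact (le_mul_of_one_le_right (by positivity) hs1).trans han
    have key : ∀ (f : Fin s → Fin s × Fin s) (c : ℝ), ∑ i, α (f i) = c →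
        |(∑ i, (r n (f i) : ℝ)) - n * c| ≤ a n := fun f c hc => by
      rw [← hc, Finset.mul_sum, ← Finset.sum_sub_distrib]
      refine (Finset.abs_sum_le_sum_abs _ _).trans
        ((Finset.sum_le_card_nsmul Finset.univ _ _ fun i _ => hrn n (f i)).trans ?_)
      rw [Finset.card_univ, Fintype.card_fin, nsmul_eq_mul]
      exact hsd
    exact ⟨fun j => key (fun i => (i, j)) _ (hα.2.1 j), fun i => key (fun j => (i, j)) _ (hα.2.2 i)⟩
  have hmass := exp_neg_klSum_le_multinomialMass (prodDist_nonneg hπ) hn0 (hr n) (hsupp n)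
  rw [lintegral_multinomialLaw]
  refine le_trans ?_ (Finset.single_le_sum (f := fun r =>
    ENNReal.ofReal (multinomialMass p r) * restrictedExp π A a n r) (fun _ _ => zero_le) (hr n))
  rw [restrictedExp, Set.indicator_of_mem hmem,
    ← ENNReal.ofReal_mul (multinomialMass_nonneg (prodDist_nonneg hπ) _),
    quadForm_centeredCounts A _ hn0]
  refine ENNReal.ofReal_le_ofReal ?_
  have hpoly : ((n : ℝ) + 1) ^ d ≤ C * Real.exp (n * (ε / 4)) := by
    have := pow_mul_exp_neg_le (show 0 < ε / 4 by positivity) d n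
    rwa [Real.exp_neg, mul_inv_le_iff₀ (Real.exp_pos _)] at this
  set D := klSum (fun i => (r n i : ℝ) / n) p
  set q := quadForm A ((fun i => (r n i : ℝ) / n) - p)
  have hm0 := multinomialMass_nonneg (prodDist_nonneg hπ) (r n)
  rw [inv_mul_le_iff₀ (by positivity)]
  have h1 : Real.exp (n * (ε / 2)) ≤ Real.exp (-(n * D)) * Real.exp (n * q) := by
    rw [← Real.exp_add, Real.exp_le_exp]
    nlinarith
  have h2 : Real.exp (n * (ε / 2)) ≤ (Real.exp 1 ^ d * C * (multinomialMass p (r n)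
      * Real.exp (n * q))) * Real.exp (n * (ε / 4)) := by
    calc _ ≤ Real.exp (-(n * D)) * Real.exp (n * q) := h1
      _ ≤ (Real.exp 1 * (n + 1)) ^ d * multinomialMass p (r n) * Real.exp (n * q) := by gcongr
      _ = Real.exp 1 ^ d * ((n : ℝ) + 1) ^ d * (multinomialMass p (r n) * Real.exp (n * q)) := by
          rw [mul_pow]
          ring
      _ ≤ Real.exp 1 ^ d * (C * Real.exp (n * (ε / 4)))
          * (multinomialMass p (r n) * Real.exp (n * q)) := by
            have : 0 ≤ multinomialMass p (r n) := hm0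
            gcongr
      _ = _ := by ring
  have h3 : Real.exp (n * (ε / 2)) = Real.exp (n * (ε / 4)) * Real.exp (n * (ε / 4)) := by
    rw [← Real.exp_add]
    congr 1
    ring
  rw [h3] at h2
  exact le_of_mul_le_mul_right h2 (Real.exp_pos _)

/-- Uniform integrability would bound every expectation by `K + 1` for a suitable `K`. -/
lemma not_uniformlyIntegrableSeq_of_tendsto_top {E : Type*} [MeasurableSpace E]
    [DiscreteMeasurableSpace E] {μ : ℕ → Measure E} (hμ : ∀ n, IsProbabilityMeasure (μ n))
    {Y : ℕ → E → ℝ≥0∞} (h : Tendsto (fun n => ∫⁻ x, Y n x ∂(μ n)) atTop (𝓝 ∞)) :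
    ¬ UniformlyIntegrableSeq μ Y := by
  intro hUI
  obtain ⟨K, hK⟩ := (hUI.eventually (gt_mem_nhds zero_lt_one)).exists
  obtain ⟨n, hn⟩ := (h.eventually (lt_mem_nhds (show (K : ℝ≥0∞) + 1 < ∞ by finiteness))).exists
  refine hn.not_ge ((lintegral_le_add_tail (μ n) (Y n) (fun _ => K) (K := K)
    fun x hx => hx).trans ?_)
  rw [lintegral_const, measure_univ, mul_one]
  exact add_le_add le_rfl ((le_iSup (fun n => ∫⁻ x in {x | (K : ℝ≥0∞) < Y n x}, Y n x ∂(μ n))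
    n).trans hK.le)

end Supercritical

/-! ### The theorem -/

theorem mainTheorem7 (s : ℕ) (π : Fin s → ℝ) (hπ : π ∈ stdSimplex ℝ (Fin s))
    (A : Matrix (Fin s × Fin s) (Fin s × Fin s) ℝ) (a : ℕ → ℝ)
    (ha_large : Tendsto (fun n : ℕ => a n / √(n : ℝ)) atTop atTop)
    (ha_small : Tendsto (fun n : ℕ => a n / (n : ℝ)) atTop (𝓝 0)) :
    (ratioSup π A < 1 →
      Tendsto (fun n : ℕ => ∫⁻ N, restrictedExp π A a n N ∂(multinomialLaw n (prodDist π)))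
        atTop (𝓝 (gaussianExpMoment (prodDist π) A))) ∧
    (ratioSup π A < 1 → MarginalInvariant π A →
      gaussianExpMoment (prodDist π) A < ∞ ∧
      UniformlyIntegrableSeq (fun n => multinomialLaw n (prodDist π)) (restrictedExp π A a)) ∧
    (1 < ratioSup π A →
      Tendsto (fun n : ℕ => ∫⁻ N, restrictedExp π A a n N ∂(multinomialLaw n (prodDist π)))
        atTop (𝓝 ∞) ∧
      ¬ UniformlyIntegrableSeq (fun n => multinomialLaw n (prodDist π))
        (restrictedExp π A a)) := by
  have hp := prodDist_nonneg hπ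
  have hp1 := sum_prodDist hπ
  refine ⟨fun h => ?_, fun h hinv => ?_, fun h => ?_⟩
  · obtain ⟨κ₁, hκ₁, hκ₁', hF⟩ := exists_quadForm_le_of_ratioSup_lt_one hπ h
    refine tendsto_order.2 ⟨fun c hc =>
      eventually_lt_lintegral_restrictedExp hπ A ha_large hc, fun c hc => ?_⟩
    -- An upper bound is only at stake for `c` above the Gaussian moment, which is then finite and
    -- supplies the quadratic bound.
    obtain ⟨κ₂, hκ₂, hκ₂', hH⟩ := exists_quadForm_le_of_gaussianExpMoment_ne_top hp hp1 hc.ne_top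
    refine eventually_lintegral_restrictedExp_lt hπ (κ := max κ₁ κ₂) (by positivity)
      (max_lt hκ₁' hκ₂') (fun α hα => (hF α hα).trans ?_) (fun x hx hx0 => (hH x hx hx0).trans ?_)
      ha_small hc
    · exact mul_le_mul_of_nonneg_right (le_max_left _ _) (klSum_nonneg hα.1.1 hp
        (eq_zero_of_mem_balancedSimplex hα) (hα.1.2.trans hp1.symm))
    · have := le_max_right κ₁ κ₂
      refine mul_le_mul_of_nonneg_right (by linarith) (Finset.sum_nonneg fun i _ =>
        div_nonneg (sq_nonneg _) (hp i))
  · obtain ⟨κ, hκ, hκ', hF⟩ := exists_quadForm_le_of_ratioSup_lt_one hπ h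
    have hH : ∀ x : Fin s × Fin s → ℝ, (∀ i, prodDist π i = 0 → x i = 0) → ∑ i, x i = 0 →
        quadForm A x ≤ κ / 2 * ∑ i, x i ^ 2 / prodDist π i := fun x hx hx0 =>
      quadForm_le_of_marginalInvariant hπ hκ.le hF hinv hx hx0
    refine ⟨?_, uniformlyIntegrableSeq_restrictedExp hπ hκ hκ' hF hH ha_small⟩
    obtain ⟨C, -, hC⟩ := exists_bound_lintegral_restrictedExp hπ hκ hκ' hF hH ha_small
    -- An infinite Gaussian moment would push the expectations above their uniform bound `C`.
    by_contra! htop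
    obtain ⟨n, hn, hn'⟩ := (hC.and (eventually_lt_lintegral_restrictedExp hπ A ha_large
      (ENNReal.ofReal_lt_top.trans_le htop))).exists
    exact hn'.not_ge hn
  · obtain ⟨α, hα, hlt⟩ := exists_klSum_lt_quadForm_of_one_lt_ratioSup hπ h
    have htop := tendsto_lintegral_restrictedExp_top hπ ha_large hα hlt
    exact ⟨htop, not_uniformlyIntegrableSeq_of_tendsto_top
      (fun n => isProbabilityMeasure_multinomialLaw hp hp1 n) htop⟩
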